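/- Let $S^3$ be the group of unit quaternions, let $T^*\subset S^3$ be the binary tetrahedral group (of order $24$) and $O^*\subset S^3$ the binary octahedral group (of order $48$), that is, the preimages under the double cover $S^3\to SO(3)$ of the rotation groups of a regular tetrahedron and of a regular octahedron. Say that a topological space $X$ can be triangulated with $n$ vertices if $X$ is homeomorphic to the polyhedron of a finite simplicial complex with exactly $n$ vertices. Then the octahedral space $S^3/T^*$ can be triangulated with $15$ vertices, and the truncated cube space $S^3/O^*$ can be triangulated with $16$ vertices. -/

import Mathlib

open scoped Quaternion

/-- The Lie group `S³` of unit quaternions. -/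
abbrev S3 : Type := Metric.sphere (0 : ℍ[ℝ]) 1

/-- For a set `V` of purely imaginary quaternions (a subset of `ℝ³`), the subgroup of all unit
quaternions `q` whose rotation `v ↦ q v q⁻¹` maps `V` onto itself. It is the preimage, under the
double cover `S³ → SO(3)`, of the group of rotations that preserve `V`. -/
def rotationPreimage (V : Set ℍ[ℝ]) : Subgroup S3 where
  carrier := {q | (fun v : ℍ[ℝ] => (q : ℍ[ℝ]) * v * (q : ℍ[ℝ])⁻¹) '' V = V}
  one_mem' := by simp
  mul_mem' := by
    intro a b ha hb
    simp only [Set.mem_ofPred_eq] at ha hb ⊢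
    conv_rhs => rw [← ha, ← hb, Set.image_image]
    simp [mul_assoc]
  inv_mem' := by
    intro a ha
    simp only [Set.mem_ofPred_eq] at ha ⊢
    have h0 : (a : ℍ[ℝ]) ≠ 0 := fun h => by
      have := a.2
      simp [h] at this
    conv_lhs => rw [← ha, Set.image_image]
    simp [mul_assoc, h0]

/-- The imaginary quaternion `a i + b j + c k`, i.e. the point `(a, b, c)` of `ℝ³`. -/
def imQuaternion (a b c : ℝ) : ℍ[ℝ] := ⟨0, a, b, c⟩

/-- The vertices of a regular tetrahedron centered at the origin of `ℝ³`, as imaginary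
quaternions. -/
def tetrahedronVertices : Set ℍ[ℝ] :=
  {imQuaternion 1 1 1, imQuaternion 1 (-1) (-1), imQuaternion (-1) 1 (-1),
    imQuaternion (-1) (-1) 1}

/-- The vertices of a regular octahedron centered at the origin of `ℝ³`, as imaginary
quaternions. -/
def octahedronVertices : Set ℍ[ℝ] :=
  {imQuaternion 1 0 0, imQuaternion (-1) 0 0,
    imQuaternion 0 1 0, imQuaternion 0 (-1) 0,
    imQuaternion 0 0 1, imQuaternion 0 0 (-1)}

/-- The binary tetrahedral group `T*`, of order 24. -/
def binaryTetrahedralGroup : Subgroup S3 := rotationPreimage tetrahedronVertices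

/-- The binary octahedral group `O*`, of order 48. -/
def binaryOctahedralGroup : Subgroup S3 := rotationPreimage octahedronVertices

/-- The octahedral space (spherical octahedron space) `S³/T*`, with the quotient topology. -/
abbrev OctahedralSpace : Type := S3 ⧸ binaryTetrahedralGroup

/-- The truncated cube space `S³/O*`, with the quotient topology. -/
abbrev TruncatedCubeSpace : Type := S3 ⧸ binaryOctahedralGroup

/-- `X` can be triangulated with `n` vertices: it is homeomorphic to the polyhedron of a finite
geometric simplicial complex, in some Euclidean space, that has exactly `n` vertices. -/
def HasTriangulationWithVertices (X : Type*) [TopologicalSpace X] (n : ℕ) : Prop :=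
  ∃ (d : ℕ) (K : Geometry.SimplicialComplex ℝ (EuclideanSpace ℝ (Fin d))),
    K.vertices.Finite ∧ K.vertices.ncard = n ∧ Nonempty (K.space ≃ₜ X)

/-! Let `G` be a finite subgroup of `S³` and let a convex polytope in the quaternions, with the
origin in its interior, be simplicial and invariant under right multiplication by `G`. Radial
projection of its boundary gives a `G`-invariant triangulation of `S³`. It descends to a simplicial
complex on the vertex orbits if a simplex is determined, up to `G`, by its orbit labels, and these
are distinct. The number of vertices is then the number of orbits: 15 and 16 for the two polytopes
given explicitly at the end.

`ConvexTriangulation` records what has to be verified. Each listed facet has a linear form equal to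
1 on its four vertices and less than 1 on all other points `p i * g`; the transition elements
satisfy a cocycle identity; and every triangle of a facet lies, at the level of labels, in another
facet that avoids the opposite label. Completeness of the facet list needs no separate proof: for
given `y`, a pair of facet and group element that maximizes the linear form at `y * g` has `y * g`
in its cone, since a negative coefficient would make the neighbouring form larger
(`exists_mem_cone`). The same forms give uniqueness of coordinates (`coord_unique`). Hence
`toQuotient` is a continuous bijection from a compact space to a Hausdorff space.

The inequalities are decided by exact arithmetic in ℤ[√2] (`TriangulationData.check`). They range
over the whole group, so `T*` and `O*` must be known exactly: that the listed elements belong to the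
group is a finite check, and that there are no others follows from integrality of the rotation
matrix (`exists_eq_half_of_integral`). -/

/-! ### Simplicial complexes spanned by standard basis vectors -/

section StandardComplex

variable {n : ℕ} {ι : Type*}

/-- The standard basis vectors of Euclidean space. -/
noncomputable def stdVertex (i : Fin n) : EuclideanSpace ℝ (Fin n) := EuclideanSpace.single i 1

theorem stdVertex_apply (i j : Fin n) : stdVertex i j = if j = i then 1 else 0 := by
  simp [stdVertex, PiLp.single_apply]

theorem stdVertex_injective : Function.Injective (stdVertex (n := n)) := by
  intro i j h
  have := congrArg (fun x : EuclideanSpace ℝ (Fin n) => x i) h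
  by_contra hij
  simp [stdVertex_apply, hij] at this

theorem stdVertex_affineIndependent : AffineIndependent ℝ (stdVertex (n := n)) := by
  apply LinearIndependent.affineIndependent
  have h := (EuclideanSpace.basisFun (Fin n) ℝ).toBasis.linearIndependent
  have : ⇑(EuclideanSpace.basisFun (Fin n) ℝ).toBasis = stdVertex := by
    ext i j
    simp [stdVertex]
  rwa [this] at h

open Classical in
/-- The geometric simplicial complex spanned, on the standard basis vectors of `ℝⁿ`, by a family
of finite sets of vertices. -/
noncomputable def stdComplex (S : ι → Finset (Fin n)) :
    Geometry.SimplicialComplex ℝ (EuclideanSpace ℝ (Fin n)) :=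
  Geometry.SimplicialComplex.ofAffineIndependent
    { faces := {s | ∃ f, ∃ t ⊆ S f, t.Nonempty ∧ s = t.image stdVertex}
      isRelLowerSet_faces := by
        rintro s ⟨f, t, htf, htn, rfl⟩
        refine ⟨htn.image _, fun u hu hun => ?_⟩
        obtain ⟨w, hw, rfl⟩ := Finset.subset_image_iff.1 hu
        exact ⟨f, w, hw.trans htf, Finset.image_nonempty.1 hun, rfl⟩ }
    (by
      refine stdVertex_affineIndependent.range.mono fun x hx => ?_
      simp only [Set.mem_iUnion, Finset.mem_coe] at hx
      obtain ⟨_, ⟨f, t, _, _, rfl⟩, hx⟩ := hx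
      obtain ⟨i, _, rfl⟩ := Finset.mem_image.1 hx
      exact ⟨i, rfl⟩)

open Classical in
theorem mem_faces_stdComplex {S : ι → Finset (Fin n)} {s : Finset (EuclideanSpace ℝ (Fin n))} :
    s ∈ (stdComplex S).faces ↔ ∃ f, ∃ t ⊆ S f, t.Nonempty ∧ s = t.image stdVertex := Iff.rfl

theorem vertices_stdComplex {S : ι → Finset (Fin n)} (hS : ∀ i, ∃ f, i ∈ S f) :
    (stdComplex S).vertices = Set.range stdVertex := by
  classical
  ext x
  rw [Geometry.SimplicialComplex.mem_vertices, mem_faces_stdComplex]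
  constructor
  · rintro ⟨f, t, _, _, h⟩
    have : x ∈ t.image stdVertex := h ▸ Finset.mem_singleton_self x
    obtain ⟨i, _, rfl⟩ := Finset.mem_image.1 this
    exact ⟨i, rfl⟩
  · rintro ⟨i, rfl⟩
    obtain ⟨f, hf⟩ := hS i
    exact ⟨f, {i}, by simpa using hf, by simp, by simp⟩

/-- Coordinates in the standard basis are barycentric coordinates, so the polyhedron is described by
support conditions alone. Maps out of it can be defined and compared through coordinates. -/
theorem mem_space_stdComplex {S : ι → Finset (Fin n)} {x : EuclideanSpace ℝ (Fin n)} :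
    x ∈ (stdComplex S).space ↔
      (∀ i, 0 ≤ x i) ∧ ∑ i, x i = 1 ∧ ∃ f, ∀ i, i ∉ S f → x i = 0 := by
  classical
  rw [Geometry.SimplicialComplex.mem_space_iff]
  constructor
  · rintro ⟨s, ⟨f, t, htf, htn, rfl⟩, hx⟩
    have hC : Convex ℝ {x : EuclideanSpace ℝ (Fin n) |
        (∀ i, 0 ≤ x i) ∧ ∑ i, x i = 1 ∧ ∀ i, i ∉ S f → x i = 0} := by
      rintro y ⟨hy0, hy1, hy2⟩ z ⟨hz0, hz1, hz2⟩ a b ha hb hab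
      refine ⟨fun i => ?_, ?_, fun i hi => ?_⟩
      · have := hy0 i; have := hz0 i
        simp only [PiLp.add_apply, PiLp.smul_apply, smul_eq_mul]; positivity
      · simp [Finset.sum_add_distrib, ← Finset.mul_sum, hy1, hz1, hab]
      · simp [hy2 i hi, hz2 i hi]
    have := convexHull_min (s := ((t.image stdVertex : Finset _) : Set _)) ?_ hC hx
    · exact ⟨this.1, this.2.1, f, this.2.2⟩
    · intro y hy
      obtain ⟨i, hi, rfl⟩ := Finset.mem_image.1 (Finset.mem_coe.1 hy)
      refine ⟨fun j => ?_, by simp [stdVertex_apply], fun j hj => ?_⟩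
      · rw [stdVertex_apply]; split_ifs <;> norm_num
      · rw [stdVertex_apply, if_neg]
        rintro rfl
        exact hj (htf hi)
  · rintro ⟨h0, h1, f, hf⟩
    have hsum : ∑ i ∈ S f, x i = 1 := by
      rw [← h1]
      exact Finset.sum_subset (Finset.subset_univ _) fun i _ hi => hf i hi
    refine ⟨(S f).image stdVertex, ⟨f, S f, subset_rfl, ?_, rfl⟩, ?_⟩
    · rw [Finset.nonempty_iff_ne_empty]
      intro h
      simp [h] at hsum
    · have hx : x = ∑ i ∈ S f, x i • stdVertex i := by
        ext j
        simp only [WithLp.ofLp_sum, WithLp.ofLp_smul, Finset.sum_apply, Pi.smul_apply,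
          stdVertex_apply, smul_eq_mul, mul_ite, mul_one, mul_zero, Finset.sum_ite_eq]
        split_ifs with h
        · rfl
        · exact hf j h
      rw [hx]
      exact (convex_convexHull ℝ _).sum_mem (fun i _ => h0 i) hsum fun i hi =>
        subset_convexHull ℝ _ (Finset.mem_coe.2 (Finset.mem_image_of_mem _ hi))

theorem isCompact_space_stdComplex [Finite ι] (S : ι → Finset (Fin n)) :
    IsCompact (stdComplex S).space := by
  classical
  have : (stdComplex S).faces.Finite := by
    refine ((Finset.univ : Finset (Finset (Fin n))).finite_toSet.image
      (Finset.image stdVertex)).subset ?_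
    rintro s ⟨f, t, _, _, rfl⟩
    exact ⟨t, by simp, rfl⟩
  exact this.isCompact_biUnion fun s _ => s.finite_toSet.isCompact_convexHull ℝ

end StandardComplex

/-- The coset space is the orbit space of right multiplication, and the action of a finite group is
properly discontinuous. -/
theorem t2Space_quotient_of_finite {Γ : Type*} [Group Γ] [TopologicalSpace Γ]
    [IsTopologicalGroup Γ] [T2Space Γ] [LocallyCompactSpace Γ] (G : Subgroup Γ) [Finite G] :
    T2Space (Γ ⧸ G) := by
  have : Finite G.op := Finite.of_equiv _ G.equivOp
  exact t2Space_of_properlyDiscontinuousSMul_of_t2Space (Γ := G.op) (T := Γ)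

/-! ### Invariant convex polytopes and radial projection -/

/-- A triangulation of `S³`, invariant under right multiplication by a subgroup `G`, by the radial
projections of the facets of a convex polytope. The vertices are the points `p i * g`; the facets
are the right translates by `G` of the simplices with vertices `p j * φ (base f) j` for
`j ∈ vert f`, and `ν f` is the linear form that defines the supporting hyperplane of the facet. -/
structure ConvexTriangulation (G : Subgroup S3) (n : ℕ) (ι : Type*) where
  vert : ι → Finset (Fin n)
  base : ι → Fin n
  p : Fin n → ℍ[ℝ]
  φ : Fin n → Fin n → S3
  ν : ι → ℍ[ℝ] →ₗ[ℝ] ℝ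
  card_vert : ∀ f, (vert f).card = 4
  exists_mem_vert : ∀ i, ∃ f, i ∈ vert f
  φ_mem : ∀ f, ∀ j ∈ vert f, φ (base f) j ∈ G
  -- Since `φ j k` depends on labels only, two facets with common labels agree there up to a single
  -- element of `G`.
  cocycle : ∀ f, ∀ j ∈ vert f, ∀ k ∈ vert f, φ (base f) k = φ j k * φ (base f) j
  ν_eq_one : ∀ f, ∀ j ∈ vert f, ν f (p j * φ (base f) j) = 1
  ν_lt_one : ∀ f i, ∀ g ∈ G, ¬(i ∈ vert f ∧ g = φ (base f) i) → ν f (p i * g) < 1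
  exists_adj : ∀ f, ∀ k ∈ vert f, ∃ f', k ∉ vert f' ∧ (vert f).erase k ⊆ vert f'

open Classical in
/-- Radial projection to the unit sphere. -/
noncomputable def radial (x : ℍ[ℝ]) : S3 :=
  if h : x = 0 then 1 else ⟨‖x‖⁻¹ • x, by simp [norm_smul, h]⟩

theorem coe_radial {x : ℍ[ℝ]} (h : x ≠ 0) : (radial x : ℍ[ℝ]) = ‖x‖⁻¹ • x := by
  simp [radial, h]

theorem continuousOn_radial : ContinuousOn radial {0}ᶜ := by
  rw [continuousOn_iff_continuous_domRestrict, continuous_induced_rng]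
  have : Subtype.val ∘ ({0}ᶜ : Set ℍ[ℝ]).domRestrict radial =
      fun x : ({0}ᶜ : Set ℍ[ℝ]) => ‖(x : ℍ[ℝ])‖⁻¹ • (x : ℍ[ℝ]) := by
    ext1 x
    exact coe_radial x.2
  rw [this]
  exact (continuous_subtype_val.norm.inv₀ fun x => norm_ne_zero_iff.2 x.2).smul continuous_subtype_val

theorem S3.coe_ne_zero (g : S3) : (g : ℍ[ℝ]) ≠ 0 := fun h => by
  have := g.2
  simp [h] at this

theorem radial_smul {c : ℝ} (hc : 0 < c) (x : ℍ[ℝ]) : radial (c • x) = radial x := by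
  by_cases hx : x = 0
  · simp [hx]
  · ext1
    rw [coe_radial hx, coe_radial (smul_ne_zero hc.ne' hx), norm_smul, smul_smul, Real.norm_eq_abs,
      abs_of_pos hc, mul_inv, mul_right_comm, inv_mul_cancel₀ hc.ne', one_mul]

theorem radial_coe (g : S3) : radial (g : ℍ[ℝ]) = g := by
  ext1
  rw [coe_radial g.coe_ne_zero, norm_eq_of_mem_sphere g, inv_one, one_smul]

theorem radial_mul (x : ℍ[ℝ]) (hx : x ≠ 0) (g : S3) : radial (x * g) = radial x * g := by
  ext1
  rw [Metric.unitSphere.coe_mul, coe_radial hx, coe_radial (mul_ne_zero hx g.coe_ne_zero), norm_mul,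
    norm_eq_of_mem_sphere g, mul_one, smul_mul_assoc]

/-! ### Cones over the facets: existence and uniqueness of coordinates -/

namespace ConvexTriangulation

variable {G : Subgroup S3} {n : ℕ} {ι : Type*} (T : ConvexTriangulation G n ι)

/-- The vertex with label `j` of the facet `f`. -/
noncomputable def v (f : ι) (j : Fin n) : ℍ[ℝ] := T.p j * T.φ (T.base f) j

/-- The point of the cone over the facet `f` with the given coordinates. -/
noncomputable def pt (f : ι) (x : Fin n → ℝ) : ℍ[ℝ] := ∑ j ∈ T.vert f, x j • T.v f j

theorem ν_v {f : ι} {j : Fin n} (hj : j ∈ T.vert f) : T.ν f (T.v f j) = 1 := T.ν_eq_one f j hj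

theorem ν_pt (f : ι) (x : Fin n → ℝ) : T.ν f (T.pt f x) = ∑ j ∈ T.vert f, x j := by
  rw [pt, map_sum]
  refine Finset.sum_congr rfl fun j hj => ?_
  rw [map_smul, T.ν_v hj, smul_eq_mul, mul_one]

/-- Two facets that share a vertex differ there by an element of `G`, which also relates all other
common vertices. -/
theorem exists_transition {f f' : ι} {j : Fin n} (hj : j ∈ T.vert f) (hj' : j ∈ T.vert f') :
    ∃ h ∈ G, ∀ k ∈ T.vert f, k ∈ T.vert f' →
      T.φ (T.base f) k = T.φ (T.base f') k * h ∧ T.v f k = T.v f' k * (h : S3) := by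
  refine ⟨(T.φ (T.base f') j)⁻¹ * T.φ (T.base f) j,
    G.mul_mem (G.inv_mem (T.φ_mem f' j hj')) (T.φ_mem f j hj), fun k hk hk' => ?_⟩
  have h : T.φ (T.base f) k =
      T.φ (T.base f') k * ((T.φ (T.base f') j)⁻¹ * T.φ (T.base f) j) := by
    rw [T.cocycle f j hj k hk, T.cocycle f' j hj' k hk']
    group
  refine ⟨h, ?_⟩
  rw [v, h, v, Metric.unitSphere.coe_mul, mul_assoc]

/-- The form of the neighbour across the face opposite `k`, moved by the transition element `h`,
agrees with `ν f` on that face. It is strictly smaller at the remaining vertex because `k` is not a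
label of the neighbour. -/
theorem exists_functional (f : ι) {k : Fin n} (hk : k ∈ T.vert f) :
    ∃ (f' : ι) (h : S3), h ∈ G ∧ (∀ j ∈ T.vert f, j ≠ k → T.ν f' (T.v f j * h) = 1) ∧
      T.ν f' (T.v f k * h) < 1 := by
  obtain ⟨f', hk', hsub⟩ := T.exists_adj f k hk
  have hc : ((T.vert f).erase k).Nonempty := by
    rw [← Finset.card_pos, Finset.card_erase_of_mem hk, T.card_vert]
    norm_num
  obtain ⟨j₀, hj₀⟩ := hc
  obtain ⟨h, hG, hh⟩ := T.exists_transition (hsub hj₀) (Finset.mem_of_mem_erase hj₀)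
  refine ⟨f', h, hG, fun j hj hjk => ?_, ?_⟩
  · have hj' := hsub (Finset.mem_erase.2 ⟨hjk, hj⟩)
    rw [← (hh j hj' hj).2, T.ν_v hj']
  · rw [v, mul_assoc, ← Metric.unitSphere.coe_mul]
    exact T.ν_lt_one f' k _ (G.mul_mem (T.φ_mem f k hk) hG) fun H => hk' H.1

/-- The coefficients of a point with respect to the vertices of a facet are detected by the linear
forms of the adjacent facets. -/
theorem functional_pt {f : ι} {k : Fin n} (hk : k ∈ T.vert f) {f' : ι} {h : S3}
    (h1 : ∀ j ∈ T.vert f, j ≠ k → T.ν f' (T.v f j * h) = 1) (x : Fin n → ℝ) :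
    T.ν f (T.pt f x) - T.ν f' (T.pt f x * h) = x k * (1 - T.ν f' (T.v f k * h)) := by
  rw [ν_pt, pt, Finset.sum_mul, map_sum, ← Finset.sum_sub_distrib, Finset.sum_eq_single_of_mem k hk]
  · rw [smul_mul_assoc, map_smul, smul_eq_mul]
    ring
  · intro j hj hjk
    rw [smul_mul_assoc, map_smul, h1 j hj hjk, smul_eq_mul, mul_one, sub_self]

/-- By `functional_pt`, each coefficient is determined by the values of two linear forms at the
point. -/
theorem pt_injective {f : ι} {x y : Fin n → ℝ} (h : T.pt f x = T.pt f y) :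
    ∀ k ∈ T.vert f, x k = y k := by
  intro k hk
  obtain ⟨f', g, -, h1, hlt⟩ := T.exists_functional f hk
  have hx := T.functional_pt hk h1 x
  have hy := T.functional_pt hk h1 y
  rw [h, hy] at hx
  exact (mul_right_cancel₀ (sub_pos.2 hlt).ne' hx).symm

/-- Uniqueness of coefficients makes the four vertices independent, hence a basis of a space of
dimension four. -/
theorem exists_pt_eq (f : ι) (y : ℍ[ℝ]) : ∃ c : Fin n → ℝ, T.pt f c = y := by
  have hli : LinearIndependent ℝ fun j : T.vert f => T.v f j := by
    classical
    rw [Fintype.linearIndependent_iff]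
    intro c hc k
    have h0 : T.pt f (fun i => if h : i ∈ T.vert f then c ⟨i, h⟩ else 0) = T.pt f 0 := by
      have : T.pt f 0 = 0 := by simp [pt]
      rw [this, ← hc, pt, ← Finset.sum_coe_sort]
      refine Finset.sum_congr rfl fun j _ => ?_
      rw [dif_pos j.2]
    simpa using T.pt_injective h0 k k.2
  have hspan := hli.span_eq_top_of_card_eq_finrank'
    (by rw [Fintype.card_coe, T.card_vert, Quaternion.finrank_eq_four])
  have hy : y ∈ Submodule.span ℝ (Set.range fun j : T.vert f => T.v f j) := hspan ▸ trivial
  obtain ⟨c, hc⟩ := (Submodule.mem_span_range_iff_exists_fun ℝ).1 hy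
  classical
  refine ⟨fun i => if h : i ∈ T.vert f then c ⟨i, h⟩ else 0, ?_⟩
  rw [← hc, pt, ← Finset.sum_coe_sort]
  refine Finset.sum_congr rfl fun j _ => ?_
  rw [dif_pos j.2]

/-- The cones over the facets and their translates cover the space. -/
theorem exists_mem_cone [Finite ι] [Nonempty ι] [Finite G] (y : ℍ[ℝ]) :
    ∃ (f : ι) (g : S3) (c : Fin n → ℝ), g ∈ G ∧ (∀ k ∈ T.vert f, 0 ≤ c k) ∧ T.pt f c = y * g := by
  -- The maximizing pair works: a negative coefficient at `k` would make the form of the neighbour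
  -- opposite `k` larger at `y * (g * h)`.
  obtain ⟨⟨f, g, hg⟩, hmax⟩ := Finite.exists_max fun a : ι × G => T.ν a.1 (y * (a.2 : S3))
  obtain ⟨c, hc⟩ := T.exists_pt_eq f (y * g)
  refine ⟨f, g, c, hg, fun k hk => ?_, hc⟩
  obtain ⟨f', h, hG, h1, hlt⟩ := T.exists_functional f hk
  have hx := T.functional_pt hk h1 c
  have hm := hmax ⟨f', g * h, G.mul_mem hg hG⟩
  simp only [Metric.unitSphere.coe_mul] at hm
  rw [hc, mul_assoc] at hx
  by_contra! hneg
  nlinarith [mul_pos_of_neg_of_neg hneg (sub_neg.2 hlt)]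

variable {T} in
theorem ν_pt_mul_le {f f' : ι} {x : Fin n → ℝ} (hx : ∀ i, 0 ≤ x i) {g : S3} (hg : g ∈ G) :
    T.ν f (T.pt f' x * g) ≤ ∑ j ∈ T.vert f', x j := by
  rw [pt, Finset.sum_mul, map_sum]
  refine Finset.sum_le_sum fun j hj => ?_
  rw [smul_mul_assoc, map_smul, smul_eq_mul, v, mul_assoc, ← Metric.unitSphere.coe_mul]
  refine mul_le_of_le_one_right (hx j) ?_
  by_cases H : j ∈ T.vert f ∧ T.φ (T.base f') j * g = T.φ (T.base f) j
  · rw [H.2]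
    exact (T.ν_eq_one f j H.1).le
  · exact (T.ν_lt_one f j _ (G.mul_mem (T.φ_mem f' j hj) hg) H).le

variable {T} in
/-- If a point of a translated facet lies on the supporting hyperplane of a facet, then all
vertices that span it are vertices of that facet. -/
theorem eq_of_ν_pt_mul_eq {f f' : ι} {x : Fin n → ℝ} (hx : ∀ i, 0 ≤ x i) {g : S3} (hg : g ∈ G)
    (h : T.ν f (T.pt f' x * g) = ∑ j ∈ T.vert f', x j) {j : Fin n} (hj : j ∈ T.vert f')
    (hxj : x j ≠ 0) : j ∈ T.vert f ∧ T.φ (T.base f') j * g = T.φ (T.base f) j := by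
  by_contra H
  have hlt : T.ν f (T.pt f' x * g) < ∑ j ∈ T.vert f', x j := by
    rw [pt, Finset.sum_mul, map_sum]
    refine Finset.sum_lt_sum (fun k hk => ?_) ⟨j, hj, ?_⟩
    · rw [smul_mul_assoc, map_smul, smul_eq_mul, v, mul_assoc, ← Metric.unitSphere.coe_mul]
      refine mul_le_of_le_one_right (hx k) ?_
      by_cases H : k ∈ T.vert f ∧ T.φ (T.base f') k * g = T.φ (T.base f) k
      · rw [H.2]
        exact (T.ν_eq_one f k H.1).le
      · exact (T.ν_lt_one f k _ (G.mul_mem (T.φ_mem f' k hk) hg) H).le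
    · rw [smul_mul_assoc, map_smul, smul_eq_mul, v, mul_assoc, ← Metric.unitSphere.coe_mul]
      exact mul_lt_of_lt_one_right ((hx j).lt_of_ne' hxj)
        (T.ν_lt_one f j _ (G.mul_mem (T.φ_mem f' j hj) hg) H)
  exact hlt.ne h

/-- Uniqueness of the coordinates of a point of the quotient. -/
theorem coord_unique {f f' : ι} {x y : Fin n → ℝ} (hx : ∀ i, 0 ≤ x i) (hy : ∀ i, 0 ≤ y i)
    (hx1 : ∑ i ∈ T.vert f, x i = 1) (hy1 : ∑ i ∈ T.vert f', y i = 1)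
    (hxf : ∀ i, i ∉ T.vert f → x i = 0) (hyf : ∀ i, i ∉ T.vert f' → y i = 0)
    {c : ℝ} (hc : 0 < c) {g : S3} (hg : g ∈ G) (h : T.pt f x = c • (T.pt f' y * g)) : x = y := by
  -- Each of the two points lies in the supporting half-space of the other's facet; this bounds `c`
  -- from both sides.
  have hle : 1 ≤ c := by
    have h1 := T.ν_pt f x
    rw [h, map_smul, smul_eq_mul, hx1] at h1
    have := T.ν_pt_mul_le (f := f) (f' := f') hy hg
    nlinarith
  have hge : c ≤ 1 := by
    have h1 := T.ν_pt f' y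
    have h2 : T.pt f' y = c⁻¹ • (T.pt f x * (g⁻¹ : S3)) := by
      rw [h, smul_mul_assoc, smul_smul, inv_mul_cancel₀ hc.ne', one_smul, mul_assoc,
        ← Metric.unitSphere.coe_mul, mul_inv_cancel, Metric.unitSphere.coe_one, mul_one]
    rw [h2, map_smul, smul_eq_mul, hy1] at h1
    have := T.ν_pt_mul_le (f := f') (f' := f) hx (G.inv_mem hg)
    rw [hx1] at this
    have : 1 ≤ c⁻¹ := by nlinarith [inv_pos.2 hc]
    exact (one_le_inv₀ hc).1 this
  obtain rfl : c = 1 := le_antisymm hge hle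
  rw [one_smul] at h
  -- With `c = 1` the translated point is on the supporting hyperplane of `f`, so every vertex of
  -- positive weight is shared and both points are combinations of the vertices of `f`.
  have hν : T.ν f (T.pt f' y * g) = ∑ j ∈ T.vert f', y j := by rw [← h, ν_pt, hx1, hy1]
  have key : T.pt f' y * g = T.pt f y := by
    rw [pt, pt, Finset.sum_mul]
    have e1 : ∀ j ∈ T.vert f', j ∉ T.vert f → y j • T.v f' j * (g : ℍ[ℝ]) = 0 := by
      intro j hj hjf
      have : y j = 0 := by
        by_contra hne
        exact hjf (eq_of_ν_pt_mul_eq hy hg hν hj hne).1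
      simp [this]
    classical
    rw [← Finset.sum_subset (s₁ := T.vert f' ∩ T.vert f) Finset.inter_subset_left (fun j hj hj' =>
        e1 j hj fun H => hj' (Finset.mem_inter.2 ⟨hj, H⟩)),
      ← Finset.sum_subset (s₁ := T.vert f' ∩ T.vert f) (s₂ := T.vert f) Finset.inter_subset_right
        (fun j hj hj' => by
          rw [hyf j fun H => hj' (Finset.mem_inter.2 ⟨H, hj⟩), zero_smul])]
    refine Finset.sum_congr rfl fun j hj => ?_
    by_cases hne : y j = 0
    · simp [hne]
    · rw [smul_mul_assoc, v, mul_assoc, ← Metric.unitSphere.coe_mul,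
        (eq_of_ν_pt_mul_eq hy hg hν (Finset.mem_inter.1 hj).1 hne).2, v]
  rw [key] at h
  ext i
  by_cases hi : i ∈ T.vert f
  · exact T.pt_injective h i hi
  · rw [hxf i hi]
    by_contra hne
    refine hi (eq_of_ν_pt_mul_eq hy hg hν (j := i) ?_ (Ne.symm hne)).1
    by_contra H
    exact hne (hyf i H).symm

theorem pt_ne_zero {f : ι} {x : Fin n → ℝ} (h : ∑ i ∈ T.vert f, x i = 1) : T.pt f x ≠ 0 := by
  intro h0
  have := T.ν_pt f x
  rw [h0, map_zero, h] at this
  exact zero_ne_one this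

theorem sum_vert {f : ι} {x : EuclideanSpace ℝ (Fin n)} (h1 : ∑ i, x i = 1)
    (hf : ∀ i, i ∉ T.vert f → x i = 0) : ∑ i ∈ T.vert f, x i = 1 := by
  rw [← h1]
  exact Finset.sum_subset (Finset.subset_univ _) fun i _ hi => hf i hi

/-! ### The homeomorphism from the polyhedron to the quotient -/

/-- The point of the quotient with the given coordinates in a facet. -/
noncomputable def chart (f : ι) (x : EuclideanSpace ℝ (Fin n)) : S3 ⧸ G :=
  QuotientGroup.mk (radial (T.pt f x))

theorem continuousOn_chart (f : ι) : ContinuousOn (T.chart f) {x | ∑ i ∈ T.vert f, x i = 1} := by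
  refine QuotientGroup.continuous_mk.comp_continuousOn (continuousOn_radial.comp ?_ fun x hx => ?_)
  · refine Continuous.continuousOn ?_
    unfold pt
    fun_prop
  · exact T.pt_ne_zero hx

/-- On the common support the two cone points differ by right multiplication by one element of `G`,
which disappears in the coset space. A common label exists because the coordinates sum to 1. -/
theorem chart_eq_chart {f f' : ι} {x : EuclideanSpace ℝ (Fin n)} (h1 : ∑ i, x i = 1)
    (hf : ∀ i, i ∉ T.vert f → x i = 0) (hf' : ∀ i, i ∉ T.vert f' → x i = 0) :
    T.chart f x = T.chart f' x := by
  classical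
  obtain ⟨j, -, hj⟩ : ∃ j ∈ Finset.univ, x j ≠ 0 := by
    refine Finset.exists_ne_zero_of_sum_ne_zero ?_
    rw [h1]
    exact one_ne_zero
  have hjf : j ∈ T.vert f := by_contra fun H => hj (hf j H)
  have hjf' : j ∈ T.vert f' := by_contra fun H => hj (hf' j H)
  obtain ⟨h, hG, hh⟩ := T.exists_transition hjf hjf'
  have key : T.pt f x = T.pt f' x * (h : S3) := by
    rw [pt, pt, Finset.sum_mul,
      ← Finset.sum_subset (s₁ := T.vert f ∩ T.vert f') Finset.inter_subset_left (fun i hi hi' => by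
          rw [hf' i fun H => hi' (Finset.mem_inter.2 ⟨hi, H⟩), zero_smul]),
      ← Finset.sum_subset (s₁ := T.vert f ∩ T.vert f') Finset.inter_subset_right (fun i hi hi' => by
          rw [hf i fun H => hi' (Finset.mem_inter.2 ⟨H, hi⟩), zero_smul, zero_mul])]
    refine Finset.sum_congr rfl fun k hk => ?_
    rw [(hh k (Finset.mem_inter.1 hk).1 (Finset.mem_inter.1 hk).2).2, smul_mul_assoc]
  rw [chart, chart, key, radial_mul _ (T.pt_ne_zero (T.sum_vert h1 hf'))]
  exact QuotientGroup.mk_mul_of_mem _ hG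

/-- The map from the polyhedron to the quotient. -/
noncomputable def toQuotient (x : (stdComplex T.vert).space) : S3 ⧸ G :=
  T.chart (mem_space_stdComplex.1 x.2).2.2.choose x

theorem toQuotient_eq {x : (stdComplex T.vert).space} {f : ι}
    (hf : ∀ i, i ∉ T.vert f → x.1 i = 0) : T.toQuotient x = T.chart f x :=
  T.chart_eq_chart (mem_space_stdComplex.1 x.2).2.1
    (mem_space_stdComplex.1 x.2).2.2.choose_spec hf

theorem continuous_toQuotient [Finite ι] : Continuous T.toQuotient := by
  let A : ι → Set (stdComplex T.vert).space := fun f => {x | ∀ i, i ∉ T.vert f → x.1 i = 0}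
  refine (locallyFinite_of_finite A).continuous ?_ (fun f => ?_) fun f => ?_
  · exact Set.iUnion_eq_univ_iff.2 fun x => (mem_space_stdComplex.1 x.2).2.2
  · simp only [A, Set.ofPred_forall]
    exact isClosed_iInter fun i => isClosed_iInter fun _ =>
      isClosed_eq (by fun_prop) continuous_const
  · have : ContinuousOn (fun x : (stdComplex T.vert).space => T.chart f x) (A f) :=
      (T.continuousOn_chart f).comp continuous_subtype_val.continuousOn fun x hx =>
        T.sum_vert (mem_space_stdComplex.1 x.2).2.1 hx
    exact this.congr fun x hx => T.toQuotient_eq hx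

/-- Equal cosets mean that the two cone points agree up to an element of `G` and a positive factor,
the ratio of their norms; `coord_unique` allows for both. -/
theorem toQuotient_injective : Function.Injective T.toQuotient := by
  intro x y hxy
  obtain ⟨hx0, hx1, f, hxf⟩ := mem_space_stdComplex.1 x.2
  obtain ⟨hy0, hy1, f', hyf⟩ := mem_space_stdComplex.1 y.2
  have hx := T.sum_vert hx1 hxf
  have hy := T.sum_vert hy1 hyf
  rw [T.toQuotient_eq hxf, T.toQuotient_eq hyf, chart, chart, eq_comm, QuotientGroup.eq] at hxy
  have hP := T.pt_ne_zero hx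
  have hQ := T.pt_ne_zero hy
  obtain ⟨g, hg, e⟩ : ∃ g ∈ G, radial (T.pt f x.1) = radial (T.pt f' y.1) * g :=
    ⟨_, hxy, by group⟩
  have e' := congrArg (Subtype.val : S3 → ℍ[ℝ]) e
  rw [Metric.unitSphere.coe_mul, coe_radial hP, coe_radial hQ] at e'
  have hP' := norm_pos_iff.2 hP
  have hQ' := norm_pos_iff.2 hQ
  have := T.coord_unique hx0 hy0 hx hy hxf hyf (c := ‖T.pt f x.1‖ * ‖T.pt f' y.1‖⁻¹)
    (by positivity) hg (by
      rw [mul_smul, ← smul_mul_assoc, ← e', smul_smul, mul_inv_cancel₀ hP'.ne', one_smul])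
  exact Subtype.ext (PiLp.ext fun i => congrFun this i)

theorem toQuotient_surjective [Finite ι] [Nonempty ι] [Finite G] :
    Function.Surjective T.toQuotient := by
  classical
  intro q
  obtain ⟨y, rfl⟩ := QuotientGroup.mk_surjective q
  obtain ⟨f, g, c, hg, hc, e⟩ := T.exists_mem_cone (y : ℍ[ℝ])
  have hs0 : 0 ≤ ∑ i ∈ T.vert f, c i := Finset.sum_nonneg hc
  have hs : 0 < ∑ i ∈ T.vert f, c i := by
    refine hs0.lt_of_ne' fun h0 => ?_
    have hz := (Finset.sum_eq_zero_iff_of_nonneg hc).1 h0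
    have : T.pt f c = 0 := Finset.sum_eq_zero fun i hi => by rw [hz i hi, zero_smul]
    rw [this] at e
    exact mul_ne_zero y.coe_ne_zero g.coe_ne_zero e.symm
  set s := ∑ i ∈ T.vert f, c i
  -- Cone coefficients become barycentric coordinates after division by their sum; radial projection
  -- ignores this positive factor.
  let x : EuclideanSpace ℝ (Fin n) := WithLp.toLp 2 fun i => if i ∈ T.vert f then s⁻¹ * c i else 0
  have hxi : ∀ i, x i = if i ∈ T.vert f then s⁻¹ * c i else 0 := fun i => rfl
  have hxf : ∀ i, i ∉ T.vert f → x i = 0 := fun i hi => by rw [hxi, if_neg hi]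
  have hx : x ∈ (stdComplex T.vert).space := by
    refine mem_space_stdComplex.2 ⟨fun i => ?_, ?_, f, hxf⟩
    · rw [hxi]
      split_ifs with h
      · exact mul_nonneg (inv_nonneg.2 hs0) (hc i h)
      · exact le_rfl
    · simp only [hxi, Finset.sum_ite_mem, Finset.univ_inter, ← Finset.mul_sum]
      exact inv_mul_cancel₀ hs.ne'
  refine ⟨⟨x, hx⟩, ?_⟩
  have hp : T.pt f x = s⁻¹ • ((y * g : S3) : ℍ[ℝ]) := by
    rw [Metric.unitSphere.coe_mul, ← e, pt, pt, Finset.smul_sum]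
    refine Finset.sum_congr rfl fun i hi => ?_
    rw [hxi, if_pos hi, mul_smul]
  rw [T.toQuotient_eq (x := ⟨x, hx⟩) hxf, chart]
  simp only [hp]
  rw [radial_smul (inv_pos.2 hs), radial_coe]
  exact QuotientGroup.mk_mul_of_mem _ hg

theorem hasTriangulationWithVertices [Finite ι] [Nonempty ι] [Finite G]
    (T : ConvexTriangulation G n ι) :
    HasTriangulationWithVertices (S3 ⧸ G) n := by
  have hv := vertices_stdComplex T.exists_mem_vert
  refine ⟨n, stdComplex T.vert, ?_, ?_, ?_⟩
  · rw [hv]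
    exact Set.finite_range _
  · rw [hv, ← Set.image_univ, Set.ncard_image_of_injective _ stdVertex_injective, Set.ncard_univ,
      Nat.card_fin]
  · have : CompactSpace (stdComplex T.vert).space :=
      isCompact_iff_compactSpace.1 (isCompact_space_stdComplex T.vert)
    have : T2Space (S3 ⧸ G) := t2Space_quotient_of_finite G
    exact ⟨T.continuous_toQuotient.homeoOfEquivCompactToT2
      (f := Equiv.ofBijective _ ⟨T.toQuotient_injective, T.toQuotient_surjective⟩)⟩

end ConvexTriangulation

/-! ### Exact arithmetic in ℤ[√2] -/

/-- The number `(p - q) + (r - s) √2`. -/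
structure Surd where
  p : ℕ
  q : ℕ
  r : ℕ
  s : ℕ

namespace Surd

def ofInt (n : ℤ) : Surd := ⟨n.toNat, (-n).toNat, 0, 0⟩

/-- The differences stay unreduced, so that ring operations are polynomials in natural numbers and
evaluate by `Nat` arithmetic alone. -/
def add (x y : Surd) : Surd :=
  ⟨Nat.add x.p y.p, Nat.add x.q y.q, Nat.add x.r y.r, Nat.add x.s y.s⟩

def neg (x : Surd) : Surd := ⟨x.q, x.p, x.s, x.r⟩

def sub (x y : Surd) : Surd :=
  ⟨Nat.add x.p y.q, Nat.add x.q y.p, Nat.add x.r y.s, Nat.add x.s y.r⟩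

def mul (x y : Surd) : Surd :=
  ⟨Nat.add (Nat.add (Nat.mul x.p y.p) (Nat.mul x.q y.q))
      (Nat.mul 2 (Nat.add (Nat.mul x.r y.r) (Nat.mul x.s y.s))),
    Nat.add (Nat.add (Nat.mul x.p y.q) (Nat.mul x.q y.p))
      (Nat.mul 2 (Nat.add (Nat.mul x.r y.s) (Nat.mul x.s y.r))),
    Nat.add (Nat.add (Nat.mul x.p y.r) (Nat.mul x.q y.s))
      (Nat.add (Nat.mul x.r y.p) (Nat.mul x.s y.q)),
    Nat.add (Nat.add (Nat.mul x.p y.s) (Nat.mul x.q y.r))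
      (Nat.add (Nat.mul x.r y.q) (Nat.mul x.s y.p))⟩

/-- The product with `√2`. -/
def sqrtTwoMul (x : Surd) : Surd := ⟨Nat.mul 2 x.r, Nat.mul 2 x.s, x.p, x.q⟩

/-- Equality of the represented numbers. -/
def beq (x y : Surd) : Bool :=
  Nat.beq (Nat.add x.p y.q) (Nat.add x.q y.p) && Nat.beq (Nat.add x.r y.s) (Nat.add x.s y.r)

/-- Whether the represented number is positive. -/
def pos (x : Surd) : Bool :=
  -- Truncated subtraction yields positive and negative parts. The positive part of either term is
  -- compared, after squaring, with the negative part of the other.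
  Nat.blt (Nat.mul 2 (Nat.mul (Nat.sub x.s x.r) (Nat.sub x.s x.r)))
      (Nat.mul (Nat.sub x.p x.q) (Nat.sub x.p x.q)) ||
    Nat.blt (Nat.mul (Nat.sub x.q x.p) (Nat.sub x.q x.p))
      (Nat.mul 2 (Nat.mul (Nat.sub x.r x.s) (Nat.sub x.r x.s)))

noncomputable def toReal (x : Surd) : ℝ := (x.p - x.q) + (x.r - x.s) * √2

theorem toReal_ofInt (n : ℤ) : (ofInt n).toReal = n := by
  have h : ((n.toNat : ℤ) : ℝ) - (((-n).toNat : ℤ) : ℝ) = n := by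
    rw [← Int.cast_sub, Int.toNat_sub_toNat_neg]
  simp only [Int.cast_natCast] at h
  simp only [toReal, ofInt, h, Nat.cast_zero, sub_zero, zero_mul, add_zero]

theorem toReal_add (x y : Surd) : (x.add y).toReal = x.toReal + y.toReal := by
  simp only [toReal, add, Nat.add_eq]; push_cast; ring

theorem toReal_sub (x y : Surd) : (x.sub y).toReal = x.toReal - y.toReal := by
  simp only [toReal, sub, Nat.add_eq]; push_cast; ring

theorem toReal_neg (x : Surd) : x.neg.toReal = -x.toReal := by
  simp only [toReal, neg]; ring

theorem toReal_mul (x y : Surd) : (x.mul y).toReal = x.toReal * y.toReal := by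
  have h : √2 * √2 = (2 : ℝ) := Real.mul_self_sqrt (by norm_num)
  simp only [toReal, mul, Nat.add_eq, Nat.mul_eq]; push_cast
  linear_combination (-((x.r : ℝ) - x.s) * (y.r - y.s)) * h

theorem toReal_sqrtTwoMul (x : Surd) : x.sqrtTwoMul.toReal = √2 * x.toReal := by
  have h : √2 * √2 = (2 : ℝ) := Real.mul_self_sqrt (by norm_num)
  simp only [toReal, sqrtTwoMul, Nat.mul_eq]; push_cast
  linear_combination (-((x.r : ℝ) - x.s)) * h

theorem toReal_eq_of_beq {x y : Surd} (h : x.beq y = true) : x.toReal = y.toReal := by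
  rw [beq, Bool.and_eq_true] at h
  replace h := And.intro (Nat.eq_of_beq_eq_true h.1) (Nat.eq_of_beq_eq_true h.2)
  simp only [Nat.add_eq] at h
  have h1 : (x.p + y.q : ℝ) = x.q + y.p := by exact_mod_cast h.1
  have h2 : (x.r + y.s : ℝ) = x.s + y.r := by exact_mod_cast h.2
  simp only [toReal]
  linear_combination h1 + √2 * h2

theorem toReal_pos {x : Surd} (h : x.pos = true) : 0 < x.toReal := by
  have h2 : √2 * √2 = (2 : ℝ) := Real.mul_self_sqrt (by norm_num)
  have h0 : 0 < √2 := by positivity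
  obtain ⟨p, q, r, s⟩ := x
  simp only [pos, Bool.or_eq_true, Nat.blt_eq, Nat.mul_eq, Nat.sub_eq] at h
  rw [toReal]
  dsimp only
  have hp : ((p : ℝ) - q) = ((p - q : ℕ) : ℝ) - ((q - p : ℕ) : ℝ) := by
    rcases le_total p q with h | h <;> simp [h, Nat.cast_sub]
  have hr : ((r : ℝ) - s) = ((r - s : ℕ) : ℝ) - ((s - r : ℕ) : ℝ) := by
    rcases le_total r s with h | h <;> simp [h, Nat.cast_sub]
  rw [hp, hr]
  rcases h with h | h
  · have hne : q - p = 0 := by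
      by_contra hne
      have : p - q = 0 := by omega
      simp [this] at h
    have h' : (2 * ((s - r : ℕ) * (s - r : ℕ)) : ℝ) < (p - q : ℕ) * (p - q : ℕ) := by
      exact_mod_cast h
    have : |((s - r : ℕ) : ℝ) * √2| < |((p - q : ℕ) : ℝ)| := by
      rw [← sq_lt_sq]
      nlinarith
    rw [abs_of_nonneg (by positivity), abs_of_nonneg (by positivity)] at this
    rw [hne, Nat.cast_zero, sub_zero]
    nlinarith [mul_nonneg (Nat.cast_nonneg (α := ℝ) (r - s)) h0.le]
  · have hne : s - r = 0 := by
      by_contra hne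
      have : r - s = 0 := by omega
      simp [this] at h
    have h' : ((q - p : ℕ) * (q - p : ℕ) : ℝ) < 2 * ((r - s : ℕ) * (r - s : ℕ)) := by
      exact_mod_cast h
    have : |((q - p : ℕ) : ℝ)| < |((r - s : ℕ) : ℝ) * √2| := by
      rw [← sq_lt_sq]
      nlinarith
    rw [abs_of_nonneg (by positivity), abs_of_nonneg (by positivity)] at this
    rw [hne, Nat.cast_zero, sub_zero]
    linarith [Nat.cast_nonneg (α := ℝ) (p - q)]

end Surd

/-! ### Quaternions over ℤ[√2] and sign-wise enumeration of the groups -/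

/-- Quaternions with coordinates in `ℤ[√2]`. -/
structure SurdQuat where
  w : Surd
  x : Surd
  y : Surd
  z : Surd

namespace SurdQuat

def ofInt (a b c d : ℤ) : SurdQuat := ⟨.ofInt a, .ofInt b, .ofInt c, .ofInt d⟩

/-- The quaternion with coordinates `√2 a`, `√2 b`, `√2 c`, `√2 d`. -/
def ofSqrtTwo (a b c d : ℤ) : SurdQuat :=
  ⟨(Surd.ofInt a).sqrtTwoMul, (Surd.ofInt b).sqrtTwoMul, (Surd.ofInt c).sqrtTwoMul,
    (Surd.ofInt d).sqrtTwoMul⟩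

def sub (p q : SurdQuat) : SurdQuat := ⟨p.w.sub q.w, p.x.sub q.x, p.y.sub q.y, p.z.sub q.z⟩
def conj (p : SurdQuat) : SurdQuat := ⟨p.w, p.x.neg, p.y.neg, p.z.neg⟩

def mul (p q : SurdQuat) : SurdQuat :=
  ⟨(((p.w.mul q.w).sub (p.x.mul q.x)).sub (p.y.mul q.y)).sub (p.z.mul q.z),
    (((p.w.mul q.x).add (p.x.mul q.w)).add (p.y.mul q.z)).sub (p.z.mul q.y),
    (((p.w.mul q.y).sub (p.x.mul q.z)).add (p.y.mul q.w)).add (p.z.mul q.x),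
    (((p.w.mul q.z).add (p.x.mul q.y)).sub (p.y.mul q.x)).add (p.z.mul q.w)⟩

def dot (p q : SurdQuat) : Surd :=
  (((p.w.mul q.w).add (p.x.mul q.x)).add (p.y.mul q.y)).add (p.z.mul q.z)

def beq (p q : SurdQuat) : Bool := p.w.beq q.w && p.x.beq q.x && p.y.beq q.y && p.z.beq q.z

/-- The determinant of the three by three matrix with the given entries. -/
def det₃ (a b c d e f g h i : Surd) : Surd :=
  ((a.mul ((e.mul i).sub (f.mul h))).sub (b.mul ((d.mul i).sub (f.mul g)))).add
    (c.mul ((d.mul h).sub (e.mul g)))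

/-- The vector product of three vectors. -/
def cross (p q r : SurdQuat) : SurdQuat :=
  ⟨det₃ p.x p.y p.z q.x q.y q.z r.x r.y r.z, (det₃ p.w p.y p.z q.w q.y q.z r.w r.y r.z).neg,
    det₃ p.w p.x p.z q.w q.x q.z r.w r.x r.z, (det₃ p.w p.x p.y q.w q.x q.y r.w r.x r.y).neg⟩

noncomputable def toQuat (p : SurdQuat) : ℍ[ℝ] :=
  ⟨p.w.toReal, p.x.toReal, p.y.toReal, p.z.toReal⟩

@[simp] theorem re_toQuat (p : SurdQuat) : p.toQuat.re = p.w.toReal := rfl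
@[simp] theorem imI_toQuat (p : SurdQuat) : p.toQuat.imI = p.x.toReal := rfl
@[simp] theorem imJ_toQuat (p : SurdQuat) : p.toQuat.imJ = p.y.toReal := rfl
@[simp] theorem imK_toQuat (p : SurdQuat) : p.toQuat.imK = p.z.toReal := rfl

theorem toQuat_mul (p q : SurdQuat) : (p.mul q).toQuat = p.toQuat * q.toQuat := by
  ext <;> simp [mul, Surd.toReal_add, Surd.toReal_sub, Surd.toReal_mul]

theorem toQuat_conj (p : SurdQuat) : p.conj.toQuat = star p.toQuat := by
  ext <;> simp [conj, Surd.toReal_neg]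

/-- The scalar product with a fixed vector, as a linear form. -/
noncomputable def dotLin (p : SurdQuat) : ℍ[ℝ] →ₗ[ℝ] ℝ where
  toFun q := p.w.toReal * q.re + p.x.toReal * q.imI + p.y.toReal * q.imJ + p.z.toReal * q.imK
  map_add' q r := by simp; ring
  map_smul' c q := by simp; ring

theorem dotLin_toQuat (p q : SurdQuat) : p.dotLin q.toQuat = (p.dot q).toReal := by
  simp [dotLin, toQuat, dot, Surd.toReal_add, Surd.toReal_mul]

/-- Left multiplication by the conjugate is the adjoint of left multiplication. One product thus
serves for testing a whole orbit against a hyperplane. -/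
theorem dot_conj_mul (p q r : SurdQuat) :
    ((p.conj.mul q).dot r).toReal = (q.dot (p.mul r)).toReal := by
  simp only [dot, conj, mul, Surd.toReal_add, Surd.toReal_sub, Surd.toReal_mul, Surd.toReal_neg]
  ring

theorem toQuat_eq_of_beq {p q : SurdQuat} (h : p.beq q = true) : p.toQuat = q.toQuat := by
  simp only [beq, Bool.and_eq_true] at h
  ext
  · exact Surd.toReal_eq_of_beq h.1.1.1
  · exact Surd.toReal_eq_of_beq h.1.1.2
  · exact Surd.toReal_eq_of_beq h.1.2
  · exact Surd.toReal_eq_of_beq h.2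

theorem norm_mul_norm_toQuat (p : SurdQuat) : ‖p.toQuat‖ * ‖p.toQuat‖ = (p.dot p).toReal := by
  rw [← Quaternion.normSq_eq_norm_mul_self, Quaternion.normSq_def']
  simp only [toQuat, dot, Surd.toReal_add, Surd.toReal_mul]
  ring

theorem norm_toQuat {e : SurdQuat} (h : (e.dot e).toReal = 4) : ‖e.toQuat‖ = 2 := by
  nlinarith [norm_nonneg e.toQuat, e.norm_mul_norm_toQuat]

open Classical in
/-- The unit quaternion `e / 2`. -/
noncomputable def half (e : SurdQuat) : S3 :=
  if h : ‖e.toQuat‖ = 2 then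
    ⟨(2⁻¹ : ℝ) • e.toQuat, by rw [mem_sphere_zero_iff_norm, norm_smul, h]; norm_num⟩
  else 1

theorem coe_half {e : SurdQuat} (h : ‖e.toQuat‖ = 2) :
    (e.half : ℍ[ℝ]) = (2⁻¹ : ℝ) • e.toQuat := by
  simp [half, h]

theorem half_congr {e e' : SurdQuat} (h : e.toQuat = e'.toQuat) : e.half = e'.half := by
  simp [half, h]

end SurdQuat

/-- The integer `1` or `-1`. -/
def sgn (a : Bool) : ℤ := cond a 1 (-1)

theorem sgn_mul_self (a : Bool) : (sgn a : ℝ) * sgn a = 1 := by cases a <;> simp [sgn]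

namespace SurdQuat

/-- Twice a unit Hurwitz quaternion. -/
def IsHurwitz (e : SurdQuat) : Prop :=
  (∃ a, e = ofInt (2 * sgn a) 0 0 0) ∨ (∃ a, e = ofInt 0 (2 * sgn a) 0 0) ∨
    (∃ a, e = ofInt 0 0 (2 * sgn a) 0) ∨ (∃ a, e = ofInt 0 0 0 (2 * sgn a)) ∨
      ∃ a b c d, e = ofInt (sgn a) (sgn b) (sgn c) (sgn d)

/-- Twice an element of the binary octahedral group that is not a Hurwitz quaternion. -/
def IsOctahedral (e : SurdQuat) : Prop :=
  (∃ a b, e = ofSqrtTwo (sgn a) (sgn b) 0 0) ∨ (∃ a b, e = ofSqrtTwo (sgn a) 0 (sgn b) 0) ∨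
    (∃ a b, e = ofSqrtTwo (sgn a) 0 0 (sgn b)) ∨ (∃ a b, e = ofSqrtTwo 0 (sgn a) (sgn b) 0) ∨
      (∃ a b, e = ofSqrtTwo 0 (sgn a) 0 (sgn b)) ∨ ∃ a b, e = ofSqrtTwo 0 0 (sgn a) (sgn b)

theorem IsHurwitz.norm_toQuat {e : SurdQuat} (h : e.IsHurwitz) : ‖e.toQuat‖ = 2 := by
  apply SurdQuat.norm_toQuat
  rcases h with ⟨a, rfl⟩ | ⟨a, rfl⟩ | ⟨a, rfl⟩ | ⟨a, rfl⟩ | ⟨a, b, c, d, rfl⟩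
  iterate 4
    simp only [dot, ofInt, Surd.toReal_add, Surd.toReal_mul, Surd.toReal_ofInt]
    push_cast
    linear_combination 4 * sgn_mul_self a
  simp only [dot, ofInt, Surd.toReal_add, Surd.toReal_mul, Surd.toReal_ofInt, sgn_mul_self]
  norm_num

theorem IsOctahedral.norm_toQuat {e : SurdQuat} (h : e.IsOctahedral) : ‖e.toQuat‖ = 2 := by
  have hr : √2 * √2 = (2 : ℝ) := Real.mul_self_sqrt (by norm_num)
  apply SurdQuat.norm_toQuat
  rcases h with ⟨a, b, rfl⟩ | ⟨a, b, rfl⟩ | ⟨a, b, rfl⟩ | ⟨a, b, rfl⟩ | ⟨a, b, rfl⟩ | ⟨a, b, rfl⟩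
  all_goals
    simp only [dot, ofSqrtTwo, Surd.toReal_add, Surd.toReal_mul, Surd.toReal_sqrtTwoMul,
      Surd.toReal_ofInt]
    push_cast
    linear_combination ((sgn a : ℝ) ^ 2 + (sgn b : ℝ) ^ 2) * hr + 2 * sgn_mul_self a +
      2 * sgn_mul_self b

theorem finite_isHurwitz : {e : SurdQuat | e.IsHurwitz}.Finite := by
  refine Set.Finite.subset (((((Set.finite_range fun a => ofInt (2 * sgn a) 0 0 0).union
    (Set.finite_range fun a => ofInt 0 (2 * sgn a) 0 0)).union
    (Set.finite_range fun a => ofInt 0 0 (2 * sgn a) 0)).union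
    (Set.finite_range fun a => ofInt 0 0 0 (2 * sgn a))).union
    (Set.finite_range fun x : Bool × Bool × Bool × Bool =>
      ofInt (sgn x.1) (sgn x.2.1) (sgn x.2.2.1) (sgn x.2.2.2))) ?_
  rintro e (⟨a, rfl⟩ | ⟨a, rfl⟩ | ⟨a, rfl⟩ | ⟨a, rfl⟩ | ⟨a, b, c, d, rfl⟩)
  · exact .inl (.inl (.inl (.inl ⟨a, rfl⟩)))
  · exact .inl (.inl (.inl (.inr ⟨a, rfl⟩)))
  · exact .inl (.inl (.inr ⟨a, rfl⟩))
  · exact .inl (.inr ⟨a, rfl⟩)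
  · exact .inr ⟨⟨a, b, c, d⟩, rfl⟩

theorem finite_isOctahedral : {e : SurdQuat | e.IsOctahedral}.Finite := by
  refine Set.Finite.subset ((((((Set.finite_range fun x : Bool × Bool =>
      ofSqrtTwo (sgn x.1) (sgn x.2) 0 0).union
    (Set.finite_range fun x : Bool × Bool => ofSqrtTwo (sgn x.1) 0 (sgn x.2) 0)).union
    (Set.finite_range fun x : Bool × Bool => ofSqrtTwo (sgn x.1) 0 0 (sgn x.2))).union
    (Set.finite_range fun x : Bool × Bool => ofSqrtTwo 0 (sgn x.1) (sgn x.2) 0)).union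
    (Set.finite_range fun x : Bool × Bool => ofSqrtTwo 0 (sgn x.1) 0 (sgn x.2))).union
    (Set.finite_range fun x : Bool × Bool => ofSqrtTwo 0 0 (sgn x.1) (sgn x.2))) ?_
  rintro e (⟨a, b, rfl⟩ | ⟨a, b, rfl⟩ | ⟨a, b, rfl⟩ | ⟨a, b, rfl⟩ | ⟨a, b, rfl⟩ | ⟨a, b, rfl⟩)
  · exact .inl (.inl (.inl (.inl (.inl ⟨(a, b), rfl⟩))))
  · exact .inl (.inl (.inl (.inl (.inr ⟨(a, b), rfl⟩))))
  · exact .inl (.inl (.inl (.inr ⟨(a, b), rfl⟩)))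
  · exact .inl (.inl (.inr ⟨(a, b), rfl⟩))
  · exact .inl (.inr ⟨(a, b), rfl⟩)
  · exact .inr ⟨(a, b), rfl⟩

/-- Whether a predicate holds for `t - x` and for `t + x`. -/
def bothSigns (x t : Surd) (P : Bool → Surd → Bool) : Bool := P true (t.sub x) && P false (t.add x)

theorem bothSigns_spec {x t : Surd} {P : Bool → Surd → Bool} (h : bothSigns x t P = true)
    (a : Bool) : ∃ s : Surd, s.toReal = t.toReal - sgn a * x.toReal ∧ P a s = true := by
  rw [bothSigns, Bool.and_eq_true] at h
  cases a
  · exact ⟨_, by simp [Surd.toReal_add, sgn], h.2⟩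
  · exact ⟨_, by simp [Surd.toReal_sub, sgn], h.1⟩

/-- Whether a predicate holds for all doubled unit Hurwitz quaternions `e` and the corresponding
numbers `t - m ⬝ e`. -/
def allHurwitz (m : SurdQuat) (t : Surd) (P : SurdQuat → Surd → Bool) : Bool :=
  (bothSigns (m.w.add m.w) t fun a s => P (ofInt (2 * sgn a) 0 0 0) s) &&
  (bothSigns (m.x.add m.x) t fun a s => P (ofInt 0 (2 * sgn a) 0 0) s) &&
  (bothSigns (m.y.add m.y) t fun a s => P (ofInt 0 0 (2 * sgn a) 0) s) &&
  (bothSigns (m.z.add m.z) t fun a s => P (ofInt 0 0 0 (2 * sgn a)) s) &&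
  -- Nesting shares the partial sums among the 16 sign patterns.
  bothSigns m.w t fun a s => bothSigns m.x s fun b s => bothSigns m.y s fun c s =>
    bothSigns m.z s fun d s => P (ofInt (sgn a) (sgn b) (sgn c) (sgn d)) s

/-- The analogue of `allHurwitz` for the other elements of the binary octahedral group. -/
def allOctahedral (m : SurdQuat) (t : Surd) (P : SurdQuat → Surd → Bool) : Bool :=
  let w := m.w.sqrtTwoMul
  let x := m.x.sqrtTwoMul
  let y := m.y.sqrtTwoMul
  let z := m.z.sqrtTwoMul
  (bothSigns w t fun a s => bothSigns x s fun b s => P (ofSqrtTwo (sgn a) (sgn b) 0 0) s) &&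
  (bothSigns w t fun a s => bothSigns y s fun b s => P (ofSqrtTwo (sgn a) 0 (sgn b) 0) s) &&
  (bothSigns w t fun a s => bothSigns z s fun b s => P (ofSqrtTwo (sgn a) 0 0 (sgn b)) s) &&
  (bothSigns x t fun a s => bothSigns y s fun b s => P (ofSqrtTwo 0 (sgn a) (sgn b) 0) s) &&
  (bothSigns x t fun a s => bothSigns z s fun b s => P (ofSqrtTwo 0 (sgn a) 0 (sgn b)) s) &&
  bothSigns y t fun a s => bothSigns z s fun b s => P (ofSqrtTwo 0 0 (sgn a) (sgn b)) s

theorem allHurwitz_spec {m : SurdQuat} {t : Surd} {P : SurdQuat → Surd → Bool}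
    (h : allHurwitz m t P = true) {e : SurdQuat} (he : e.IsHurwitz) :
    ∃ s : Surd, s.toReal = t.toReal - (m.dot e).toReal ∧ P e s = true := by
  simp only [allHurwitz, Bool.and_eq_true] at h
  obtain ⟨⟨⟨⟨h1, h2⟩, h3⟩, h4⟩, h5⟩ := h
  have key : ∀ a b c d : ℤ, (m.dot (ofInt a b c d)).toReal =
      a * m.w.toReal + b * m.x.toReal + c * m.y.toReal + d * m.z.toReal := by
    intro a b c d
    simp only [dot, ofInt, Surd.toReal_add, Surd.toReal_mul, Surd.toReal_ofInt]
    ring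
  rcases he with ⟨a, rfl⟩ | ⟨a, rfl⟩ | ⟨a, rfl⟩ | ⟨a, rfl⟩ | ⟨a, b, c, d, rfl⟩
  · obtain ⟨s, hs, hP⟩ := bothSigns_spec h1 a
    refine ⟨s, ?_, hP⟩
    rw [hs, key, Surd.toReal_add]; push_cast; ring
  · obtain ⟨s, hs, hP⟩ := bothSigns_spec h2 a
    refine ⟨s, ?_, hP⟩
    rw [hs, key, Surd.toReal_add]; push_cast; ring
  · obtain ⟨s, hs, hP⟩ := bothSigns_spec h3 a
    refine ⟨s, ?_, hP⟩
    rw [hs, key, Surd.toReal_add]; push_cast; ring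
  · obtain ⟨s, hs, hP⟩ := bothSigns_spec h4 a
    refine ⟨s, ?_, hP⟩
    rw [hs, key, Surd.toReal_add]; push_cast; ring
  · obtain ⟨s1, hs1, hP⟩ := bothSigns_spec h5 a
    obtain ⟨s2, hs2, hP⟩ := bothSigns_spec hP b
    obtain ⟨s3, hs3, hP⟩ := bothSigns_spec hP c
    obtain ⟨s, hs, hP⟩ := bothSigns_spec hP d
    refine ⟨s, ?_, hP⟩
    rw [hs, hs3, hs2, hs1, key]; ring

theorem allOctahedral_spec {m : SurdQuat} {t : Surd} {P : SurdQuat → Surd → Bool}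
    (h : allOctahedral m t P = true) {e : SurdQuat} (he : e.IsOctahedral) :
    ∃ s : Surd, s.toReal = t.toReal - (m.dot e).toReal ∧ P e s = true := by
  simp only [allOctahedral, Bool.and_eq_true] at h
  obtain ⟨⟨⟨⟨⟨h1, h2⟩, h3⟩, h4⟩, h5⟩, h6⟩ := h
  have key : ∀ a b c d : ℤ, (m.dot (ofSqrtTwo a b c d)).toReal =
      √2 * (a * m.w.toReal + b * m.x.toReal + c * m.y.toReal + d * m.z.toReal) := by
    intro a b c d
    simp only [dot, ofSqrtTwo, Surd.toReal_add, Surd.toReal_mul, Surd.toReal_sqrtTwoMul,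
      Surd.toReal_ofInt]
    ring
  rcases he with ⟨a, b, rfl⟩ | ⟨a, b, rfl⟩ | ⟨a, b, rfl⟩ | ⟨a, b, rfl⟩ | ⟨a, b, rfl⟩ | ⟨a, b, rfl⟩
  · obtain ⟨s1, hs1, hP⟩ := bothSigns_spec h1 a
    obtain ⟨s, hs, hP⟩ := bothSigns_spec hP b
    exact ⟨s, by rw [hs, hs1, key, Surd.toReal_sqrtTwoMul, Surd.toReal_sqrtTwoMul]; push_cast; ring, hP⟩
  · obtain ⟨s1, hs1, hP⟩ := bothSigns_spec h2 a
    obtain ⟨s, hs, hP⟩ := bothSigns_spec hP b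
    exact ⟨s, by rw [hs, hs1, key, Surd.toReal_sqrtTwoMul, Surd.toReal_sqrtTwoMul]; push_cast; ring, hP⟩
  · obtain ⟨s1, hs1, hP⟩ := bothSigns_spec h3 a
    obtain ⟨s, hs, hP⟩ := bothSigns_spec hP b
    exact ⟨s, by rw [hs, hs1, key, Surd.toReal_sqrtTwoMul, Surd.toReal_sqrtTwoMul]; push_cast; ring, hP⟩
  · obtain ⟨s1, hs1, hP⟩ := bothSigns_spec h4 a
    obtain ⟨s, hs, hP⟩ := bothSigns_spec hP b
    exact ⟨s, by rw [hs, hs1, key, Surd.toReal_sqrtTwoMul, Surd.toReal_sqrtTwoMul]; push_cast; ring, hP⟩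
  · obtain ⟨s1, hs1, hP⟩ := bothSigns_spec h5 a
    obtain ⟨s, hs, hP⟩ := bothSigns_spec hP b
    exact ⟨s, by rw [hs, hs1, key, Surd.toReal_sqrtTwoMul, Surd.toReal_sqrtTwoMul]; push_cast; ring, hP⟩
  · obtain ⟨s1, hs1, hP⟩ := bothSigns_spec h6 a
    obtain ⟨s, hs, hP⟩ := bothSigns_spec hP b
    exact ⟨s, by rw [hs, hs1, key, Surd.toReal_sqrtTwoMul, Surd.toReal_sqrtTwoMul]; push_cast; ring, hP⟩

end SurdQuat

/-! ### Triangulation data and their verification -/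

/-- Combinatorial data for a convex triangulation: elements of the group (doubled),
representatives of the orbits of vertices, the transition elements between adjacent vertices (as
indices into the list of group elements), the facets, and whether the group is the binary
octahedral or the binary tetrahedral group. -/
structure TriangulationData where
  octahedral : Bool
  elements : List SurdQuat
  points : List SurdQuat
  transitions : List (List ℕ)
  facets : List (List ℕ)

namespace TriangulationData

open SurdQuat

variable (d : TriangulationData)

/-- The elements of the group, doubled. -/
def IsElement (e : SurdQuat) : Prop := e.IsHurwitz ∨ d.octahedral = true ∧ e.IsOctahedral

def point (i : ℕ) : SurdQuat := d.points.getD i (ofInt 0 0 0 0)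

def transition (i j : ℕ) : SurdQuat :=
  d.elements.getD ((d.transitions.getD i []).getD j 0) (ofInt 2 0 0 0)

/-- Twice the vertex with label `j` of a facet with base `b`. -/
def vertex (b j : ℕ) : SurdQuat := (d.point j).mul (d.transition b j)

/-- The first vertex of a facet. -/
def head (f : List ℕ) : ℕ := f.getD 0 0

/-- A normal vector of the hyperplane through a facet. -/
def normal (f : List ℕ) : SurdQuat :=
  -- The sign of the cross product depends on the order of the labels, so the facet lists are
  -- oriented; `checkOn` confirms that the level is positive.
  let b := head f
  let o := d.vertex b b
  cross ((d.vertex b (f.getD 1 0)).sub o) ((d.vertex b (f.getD 2 0)).sub o)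
    ((d.vertex b (f.getD 3 0)).sub o)

/-- The value of the normal vector on the vertices of the facet. -/
def level (f : List ℕ) : Surd := (d.normal f).dot (d.vertex (head f) (head f))

def checkShape (f : List ℕ) : Bool :=
  Nat.beq f.length 4 && decide f.Nodup && f.all fun j => Nat.blt j d.points.length

def checkCover : Bool :=
  !d.facets.isEmpty && (List.range d.points.length).all fun i => d.facets.any fun f => f.contains i

def checkAdj (f : List ℕ) : Bool :=
  f.all fun k => d.facets.any fun f' =>
    !f'.contains k && f.all fun j => Nat.beq j k || f'.contains j

/-- All transition elements are stored doubled; the factor 2 on the left balances the two doublings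
on the right. -/
def checkCocycle (f : List ℕ) : Bool :=
  f.all fun j => f.all fun k =>
    ((ofInt 2 0 0 0).mul (d.transition (head f) k)).beq
      ((d.transition j k).mul (d.transition (head f) j))

def checkOn (f : List ℕ) (N : SurdQuat) (D : Surd) : Bool :=
  D.pos && f.all fun j => (N.dot (d.vertex (head f) j)).beq D

/-- The group is run through by sign patterns and not through `d.elements`, which only supplies
transitions. The single exception to strictness is the facet's own vertex. -/
def checkBelow (f : List ℕ) (N : SurdQuat) (D : Surd) : Bool :=
  (List.range d.points.length).all fun i =>
    let M := (d.point i).conj.mul N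
    let P := fun e (s : Surd) => s.pos || (f.contains i && e.beq (d.transition (head f) i))
    allHurwitz M D P && (!d.octahedral || allOctahedral M D P)

def checkFacet (f : List ℕ) : Bool :=
  d.checkShape f && d.checkAdj f && d.checkCocycle f && d.checkOn f (d.normal f) (d.level f) &&
    d.checkBelow f (d.normal f) (d.level f)

def check : Bool := d.checkCover && d.facets.all fun f => d.checkFacet f

end TriangulationData

/-- The elements of the binary tetrahedral group, doubled. -/
def hurwitzUnits : List SurdQuat := [
  .ofInt 2 0 0 0, .ofInt (-2) 0 0 0, .ofInt 0 (-2) 0 0, .ofInt 0 2 0 0, .ofInt 0 0 (-2) 0,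
  .ofInt 0 0 2 0, .ofInt 0 0 0 (-2), .ofInt 0 0 0 2, .ofInt (-1) (-1) (-1) (-1),
  .ofInt 1 (-1) (-1) (-1), .ofInt (-1) 1 (-1) (-1), .ofInt 1 1 (-1) (-1), .ofInt (-1) (-1) 1 (-1),
  .ofInt 1 (-1) 1 (-1), .ofInt (-1) 1 1 (-1), .ofInt 1 1 1 (-1), .ofInt (-1) (-1) (-1) 1,
  .ofInt 1 (-1) (-1) 1, .ofInt (-1) 1 (-1) 1, .ofInt 1 1 (-1) 1, .ofInt (-1) (-1) 1 1,
  .ofInt 1 (-1) 1 1, .ofInt (-1) 1 1 1, .ofInt 1 1 1 1]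

/-- The other elements of the binary octahedral group, doubled. -/
def octahedralUnits : List SurdQuat := [
  .ofSqrtTwo (-1) (-1) 0 0, .ofSqrtTwo 1 (-1) 0 0, .ofSqrtTwo (-1) 1 0 0, .ofSqrtTwo 1 1 0 0,
  .ofSqrtTwo (-1) 0 (-1) 0, .ofSqrtTwo 1 0 (-1) 0, .ofSqrtTwo (-1) 0 1 0, .ofSqrtTwo 1 0 1 0,
  .ofSqrtTwo (-1) 0 0 (-1), .ofSqrtTwo 1 0 0 (-1), .ofSqrtTwo (-1) 0 0 1, .ofSqrtTwo 1 0 0 1,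
  .ofSqrtTwo 0 (-1) (-1) 0, .ofSqrtTwo 0 1 (-1) 0, .ofSqrtTwo 0 (-1) 1 0, .ofSqrtTwo 0 1 1 0,
  .ofSqrtTwo 0 (-1) 0 (-1), .ofSqrtTwo 0 1 0 (-1), .ofSqrtTwo 0 (-1) 0 1, .ofSqrtTwo 0 1 0 1,
  .ofSqrtTwo 0 0 (-1) (-1), .ofSqrtTwo 0 0 1 (-1), .ofSqrtTwo 0 0 (-1) 1, .ofSqrtTwo 0 0 1 1]

/-! ### Determination of the elements of `T*` and `O*` -/

theorem S3.coe_inv (q : S3) : ((q : ℍ[ℝ]))⁻¹ = star (q : ℍ[ℝ]) := by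
  rw [Quaternion.inv_def, Quaternion.normSq_eq_norm_mul_self, norm_eq_of_mem_sphere q]
  simp

/-- An injective map of a finite set into itself is onto. -/
theorem mem_rotationPreimage_of_mapsTo {V : Set ℍ[ℝ]} (hV : V.Finite) {q : S3}
    (h : ∀ v ∈ V, (q : ℍ[ℝ]) * v * star (q : ℍ[ℝ]) ∈ V) : q ∈ rotationPreimage V := by
  change (fun v : ℍ[ℝ] => (q : ℍ[ℝ]) * v * (q : ℍ[ℝ])⁻¹) '' V = V
  refine Set.eq_of_subset_of_ncard_le ?_ ?_ hV
  · rintro _ ⟨v, hv, rfl⟩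
    simpa only [S3.coe_inv] using h v hv
  · rw [Set.ncard_image_of_injective]
    intro v w hvw
    exact mul_left_cancel₀ q.coe_ne_zero
      (mul_right_cancel₀ (inv_ne_zero q.coe_ne_zero) hvw)

theorem conj_mem_of_mem_rotationPreimage {V : Set ℍ[ℝ]} {q : S3} (hq : q ∈ rotationPreimage V)
    {v : ℍ[ℝ]} (hv : v ∈ V) : (q : ℍ[ℝ]) * v * star (q : ℍ[ℝ]) ∈ V := by
  have hq' : (fun v : ℍ[ℝ] => (q : ℍ[ℝ]) * v * (q : ℍ[ℝ])⁻¹) '' V = V := hq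
  rw [← S3.coe_inv, ← hq']
  exact ⟨v, hv, rfl⟩

theorem imQuaternion_add (a b c a' b' c' : ℝ) :
    imQuaternion a b c + imQuaternion a' b' c' = imQuaternion (a + a') (b + b') (c + c') := by
  ext
  · change (0 + 0 : ℝ) = 0; norm_num
  all_goals rfl

theorem smul_imQuaternion (r a b c : ℝ) :
    r • imQuaternion a b c = imQuaternion (r * a) (r * b) (r * c) := by
  ext
  · change r * 0 = 0; norm_num
  all_goals rfl

/-- The rotation defined by a quaternion, in coordinates. -/
theorem mul_imQuaternion_mul_star (q : ℍ[ℝ]) (x y z : ℝ) :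
    q * imQuaternion x y z * star q = imQuaternion
      ((q.re ^ 2 + q.imI ^ 2 - q.imJ ^ 2 - q.imK ^ 2) * x +
        2 * (q.imI * q.imJ - q.re * q.imK) * y + 2 * (q.imI * q.imK + q.re * q.imJ) * z)
      (2 * (q.imI * q.imJ + q.re * q.imK) * x +
        (q.re ^ 2 - q.imI ^ 2 + q.imJ ^ 2 - q.imK ^ 2) * y +
        2 * (q.imJ * q.imK - q.re * q.imI) * z)
      (2 * (q.imI * q.imK - q.re * q.imJ) * x + 2 * (q.imJ * q.imK + q.re * q.imI) * y +
        (q.re ^ 2 - q.imI ^ 2 - q.imJ ^ 2 + q.imK ^ 2) * z) := by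
  have h0 (a b c : ℝ) : (imQuaternion a b c).re = 0 := rfl
  have h1 (a b c : ℝ) : (imQuaternion a b c).imI = a := rfl
  have h2 (a b c : ℝ) : (imQuaternion a b c).imJ = b := rfl
  have h3 (a b c : ℝ) : (imQuaternion a b c).imK = c := rfl
  ext <;> simp [h0, h1, h2, h3] <;> ring

namespace SurdQuat

theorem toQuat_ofInt (a b c d : ℤ) : (ofInt a b c d).toQuat = ⟨a, b, c, d⟩ := by
  ext <;> exact Surd.toReal_ofInt _

theorem toQuat_ofInt_real (a : ℤ) : (ofInt a 0 0 0).toQuat = ((a : ℝ) : ℍ[ℝ]) := by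
  rw [toQuat_ofInt]
  ext <;> simp

theorem toQuat_ofInt_im (a b c : ℤ) : (ofInt 0 a b c).toQuat = imQuaternion a b c := by
  rw [toQuat_ofInt, imQuaternion, Int.cast_zero]

theorem half_mul_toQuat_mul_star {e : SurdQuat} (h : ‖e.toQuat‖ = 2) (v : SurdQuat) :
    (e.half : ℍ[ℝ]) * v.toQuat * star (e.half : ℍ[ℝ]) =
      (4⁻¹ : ℝ) • ((e.mul v).mul e.conj).toQuat := by
  rw [coe_half h, toQuat_mul, toQuat_mul, toQuat_conj, Quaternion.star_smul, smul_mul_assoc, smul_mul_assoc,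
    mul_smul_comm, smul_smul]
  norm_num

/-- Whether conjugation with `e` preserves a set of vectors. -/
def preserves (V : List SurdQuat) (e : SurdQuat) : Bool :=
  (e.dot e).beq ⟨4, 0, 0, 0⟩ &&
    -- The factor 4 comes from doubling both `e` and its conjugate.
    V.all fun v => V.any fun v' => ((e.mul v).mul e.conj).beq ((ofInt 4 0 0 0).mul v')

theorem norm_toQuat_of_preserves {V : List SurdQuat} {e : SurdQuat} (h : preserves V e = true) :
    ‖e.toQuat‖ = 2 := by
  rw [preserves, Bool.and_eq_true] at h
  apply norm_toQuat
  rw [Surd.toReal_eq_of_beq h.1]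
  simp [Surd.toReal]

theorem half_mem_rotationPreimage {V : List SurdQuat} {W : Set ℍ[ℝ]}
    (hW : W = toQuat '' {v | v ∈ V}) {e : SurdQuat} (h : preserves V e = true) :
    e.half ∈ rotationPreimage W := by
  subst hW
  refine mem_rotationPreimage_of_mapsTo ((List.finite_toSet V).image _) ?_
  rintro _ ⟨v, hv, rfl⟩
  have hn := norm_toQuat_of_preserves h
  rw [preserves, Bool.and_eq_true, List.all_eq_true] at h
  obtain ⟨v', hv', hb⟩ := List.any_eq_true.1 (h.2 v hv)
  refine ⟨v', hv', ?_⟩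
  rw [half_mul_toQuat_mul_star hn, toQuat_eq_of_beq hb, toQuat_mul, toQuat_ofInt_real,
    Quaternion.coe_mul_eq_smul, smul_smul]
  norm_num

def tetrahedronList : List SurdQuat :=
  [ofInt 0 1 1 1, ofInt 0 1 (-1) (-1), ofInt 0 (-1) 1 (-1), ofInt 0 (-1) (-1) 1]

def octahedronList : List SurdQuat :=
  [ofInt 0 1 0 0, ofInt 0 (-1) 0 0, ofInt 0 0 1 0, ofInt 0 0 (-1) 0, ofInt 0 0 0 1,
    ofInt 0 0 0 (-1)]

theorem tetrahedronVertices_eq : tetrahedronVertices = toQuat '' {v | v ∈ tetrahedronList} := by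
  ext v
  simp [tetrahedronVertices, tetrahedronList, toQuat_ofInt_im, eq_comm]

theorem octahedronVertices_eq : octahedronVertices = toQuat '' {v | v ∈ octahedronList} := by
  ext v
  simp [octahedronVertices, octahedronList, toQuat_ofInt_im, eq_comm]

theorem half_mem_binaryTetrahedralGroup {e : SurdQuat} (he : e ∈ hurwitzUnits) :
    e.half ∈ binaryTetrahedralGroup := by
  refine half_mem_rotationPreimage tetrahedronVertices_eq ?_
  have : (hurwitzUnits.all fun e => preserves tetrahedronList e) = true := by decide +kernel
  exact List.all_eq_true.1 this e he

theorem half_mem_binaryOctahedralGroup {e : SurdQuat} (he : e ∈ hurwitzUnits ++ octahedralUnits) :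
    e.half ∈ binaryOctahedralGroup := by
  refine half_mem_rotationPreimage octahedronVertices_eq ?_
  have : ((hurwitzUnits ++ octahedralUnits).all fun e => preserves octahedronList e) = true := by
    decide +kernel
  exact List.all_eq_true.1 this e he

/-- A rotation by an element of the second kind changes the orientation of the tetrahedron. -/
theorem IsOctahedral.half_notMem {e : SurdQuat} (he : e.IsOctahedral) :
    e.half ∉ binaryTetrahedralGroup := by
  intro h
  have hn := he.norm_toQuat
  let u := (e.mul (ofInt 0 1 1 1)).mul e.conj
  -- The product of the three coordinates is 1 at each vertex of the tetrahedron, but -1 at the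
  -- image of (1, 1, 1); the scale 4 cubed gives -64.
  have hu : ((u.x.mul u.y).mul u.z).beq ⟨0, 64, 0, 0⟩ = true := by
    rcases he with ⟨a, b, rfl⟩ | ⟨a, b, rfl⟩ | ⟨a, b, rfl⟩ | ⟨a, b, rfl⟩ | ⟨a, b, rfl⟩ |
      ⟨a, b, rfl⟩ <;> cases a <;> cases b <;> rfl
  have hu' := Surd.toReal_eq_of_beq hu
  rw [Surd.toReal_mul, Surd.toReal_mul] at hu'
  have h1 : (ofInt 0 1 1 1).toQuat ∈ tetrahedronVertices := by
    rw [tetrahedronVertices_eq]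
    exact ⟨_, by simp [tetrahedronList], rfl⟩
  have hm := conj_mem_of_mem_rotationPreimage h h1
  rw [half_mul_toQuat_mul_star hn] at hm
  have hp : ∀ v ∈ tetrahedronVertices, v.imI * v.imJ * v.imK = 1 := by
    rintro v (rfl | rfl | rfl | rfl) <;> simp [imQuaternion]
  have := hp _ hm
  change (4⁻¹ * u.x.toReal) * (4⁻¹ * u.y.toReal) * (4⁻¹ * u.z.toReal) = 1 at this
  simp only [Surd.toReal, CharP.cast_eq_zero, Nat.cast_ofNat] at hu'
  simp only [Surd.toReal] at this
  linarith

/-- Here `A`, `B`, `C`, `D` stand for the squares of the doubled coordinates of a unit quaternion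
with integral rotation matrix. -/
theorem square_classification : ∀ A B C D : Fin 5, A.val + B.val + C.val + D.val = 4 →
    (∃ n : Fin 5, n.val * n.val = A.val * B.val) → (∃ n : Fin 5, n.val * n.val = A.val * C.val) →
    (∃ n : Fin 5, n.val * n.val = A.val * D.val) → (∃ n : Fin 5, n.val * n.val = B.val * C.val) →
    (∃ n : Fin 5, n.val * n.val = B.val * D.val) → (∃ n : Fin 5, n.val * n.val = C.val * D.val) →
    (A, B, C, D) ∈ ([(4, 0, 0, 0), (0, 4, 0, 0), (0, 0, 4, 0), (0, 0, 0, 4), (1, 1, 1, 1),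
      (2, 2, 0, 0), (2, 0, 2, 0), (2, 0, 0, 2), (0, 2, 2, 0), (0, 2, 0, 2), (0, 0, 2, 2)] :
        List (Fin 5 × Fin 5 × Fin 5 × Fin 5)) := by
  decide +kernel

theorem eq_sgn_mul {x y : ℝ} (h : x ^ 2 = y ^ 2) : ∃ a, x = sgn a * y := by
  rcases sq_eq_sq_iff_eq_or_eq_neg.1 h with h | h
  · exact ⟨true, by simp [sgn, h]⟩
  · exact ⟨false, by simp [sgn, h]⟩

/-- The unit quaternions whose rotation matrix has integral entries. -/
theorem exists_eq_half_of_integral (q : S3)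
    (hI : ∀ v ∈ ({imQuaternion 1 0 0, imQuaternion 0 1 0, imQuaternion 0 0 1} : Set ℍ[ℝ]),
      ∃ x y z : ℤ, (q : ℍ[ℝ]) * v * star (q : ℍ[ℝ]) = imQuaternion x y z) :
    ∃ e : SurdQuat, (e.IsHurwitz ∨ e.IsOctahedral) ∧ q = e.half := by
  obtain ⟨x1, y1, z1, h1⟩ := hI _ (.inl rfl)
  obtain ⟨x2, y2, z2, h2⟩ := hI _ (.inr (.inl rfl))
  obtain ⟨x3, y3, z3, h3⟩ := hI _ (.inr (.inr rfl))
  have hn : q.1.re ^ 2 + q.1.imI ^ 2 + q.1.imJ ^ 2 + q.1.imK ^ 2 = 1 := by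
    rw [← Quaternion.normSq_def', Quaternion.normSq_eq_norm_mul_self, norm_eq_of_mem_sphere q,
      one_mul]
  rw [mul_imQuaternion_mul_star] at h1 h2 h3
  have hinj : ∀ {a b c a' b' c' : ℝ}, imQuaternion a b c = imQuaternion a' b' c' →
      a = a' ∧ b = b' ∧ c = c' := fun h =>
    ⟨congrArg (fun t : ℍ[ℝ] => t.imI) h, congrArg (fun t : ℍ[ℝ] => t.imJ) h,
      congrArg (fun t : ℍ[ℝ] => t.imK) h⟩
  obtain ⟨h11, h21, h31⟩ := hinj h1
  obtain ⟨h12, h22, h32⟩ := hinj h2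
  obtain ⟨h13, h23, h33⟩ := hinj h3
  clear h1 h2 h3 hI
  generalize ha : q.1.re = a at *
  generalize hb : q.1.imI = b at *
  generalize hc : q.1.imJ = c at *
  generalize hd : q.1.imK = d at *
  have toFin : ∀ (t : ℝ) (m : ℤ), (2 * t) ^ 2 = m → (2 * t) ^ 2 ≤ 4 →
      ∃ A : Fin 5, (2 * t) ^ 2 = (A.val : ℝ) := by
    intro t m hm hle
    have h0 : 0 ≤ m := by exact_mod_cast hm ▸ sq_nonneg (2 * t)
    have h4 : m ≤ 4 := by
      rw [hm] at hle
      exact_mod_cast hle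
    refine ⟨⟨m.toNat, by omega⟩, ?_⟩
    rw [hm]
    have : ((m.toNat : ℤ) : ℝ) = m := by rw [Int.toNat_of_nonneg h0]
    exact_mod_cast this.symm
  -- Signed sums of the diagonal entries of the matrix, plus 1, are four times the squares of the
  -- coordinates.
  obtain ⟨A, hA⟩ := toFin a (1 + x1 + y2 + z3) (by push_cast; linarith) (by nlinarith)
  obtain ⟨B, hB⟩ := toFin b (1 + x1 - y2 - z3) (by push_cast; linarith) (by nlinarith)
  obtain ⟨C, hC⟩ := toFin c (1 - x1 + y2 - z3) (by push_cast; linarith) (by nlinarith)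
  obtain ⟨D, hD⟩ := toFin d (1 - x1 - y2 + z3) (by push_cast; linarith) (by nlinarith)
  have hsum : A.val + B.val + C.val + D.val = 4 := by
    have : (A.val + B.val + C.val + D.val : ℝ) = 4 := by rw [← hA, ← hB, ← hC, ← hD]; linarith
    exact_mod_cast this
  have prod : ∀ {s t : ℝ} {m : ℤ} {S T : Fin 5}, (2 * s) ^ 2 = (S.val : ℝ) →
      (2 * t) ^ 2 = (T.val : ℝ) → 4 * (s * t) = m → ∃ n : Fin 5, n.val * n.val = S.val * T.val := by
    intro s t m S T hS hT hm
    have e : (m : ℝ) * m = S.val * T.val := by rw [← hm, ← hS, ← hT]; ring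
    have e' : m.natAbs * m.natAbs = S.val * T.val := by
      zify
      rw [abs_mul_abs_self]
      exact_mod_cast e
    have hlt : m.natAbs < 5 := by
      have := S.2
      have := T.2
      nlinarith
    exact ⟨⟨m.natAbs, hlt⟩, e'⟩
  have hq : ∀ e : SurdQuat, ‖e.toQuat‖ = 2 → 2 * a = e.w.toReal → 2 * b = e.x.toReal →
      2 * c = e.y.toReal → 2 * d = e.z.toReal → q = e.half := by
    intro e he h1 h2 h3 h4
    ext1
    rw [coe_half he]
    ext
    · change q.1.re = 2⁻¹ * e.w.toReal; linarith
    · change q.1.imI = 2⁻¹ * e.x.toReal; linarith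
    · change q.1.imJ = 2⁻¹ * e.y.toReal; linarith
    · change q.1.imK = 2⁻¹ * e.z.toReal; linarith
  -- Sums and differences of opposite off-diagonal entries are four times the products of two
  -- coordinates, so the product of any two of `A`, `B`, `C`, `D` is a square.
  have key := square_classification A B C D hsum
    (prod hA hB (m := z2 - y3) (by push_cast; linarith))
    (prod hA hC (m := x3 - z1) (by push_cast; linarith))
    (prod hA hD (m := y1 - x2) (by push_cast; linarith))
    (prod hB hC (m := y1 + x2) (by push_cast; linarith))
    (prod hB hD (m := x3 + z1) (by push_cast; linarith))
    (prod hC hD (m := z2 + y3) (by push_cast; linarith))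
  have r0 : ∀ {t : ℝ}, (2 * t) ^ 2 = ((0 : Fin 5).val : ℝ) → 2 * t = (0 : ℤ) := by
    intro t ht
    simpa using ht
  have r1 : ∀ {t : ℝ}, (2 * t) ^ 2 = ((1 : Fin 5).val : ℝ) → ∃ a, 2 * t = sgn a := by
    intro t ht
    obtain ⟨a, h⟩ := eq_sgn_mul (x := 2 * t) (y := 1) (by rw [ht]; norm_num)
    exact ⟨a, by rw [h, mul_one]⟩
  have r2 : ∀ {t : ℝ}, (2 * t) ^ 2 = ((2 : Fin 5).val : ℝ) → ∃ a, 2 * t = √2 * sgn a := by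
    intro t ht
    obtain ⟨a, h⟩ := eq_sgn_mul (x := 2 * t) (y := √2) (by rw [ht]; norm_num)
    exact ⟨a, by rw [h, mul_comm]⟩
  have r4 : ∀ {t : ℝ}, (2 * t) ^ 2 = ((4 : Fin 5).val : ℝ) → ∃ a, 2 * t = (2 * sgn a : ℤ) := by
    intro t ht
    obtain ⟨a, h⟩ := eq_sgn_mul (x := 2 * t) (y := 2) (by rw [ht]; norm_num)
    exact ⟨a, by rw [h]; push_cast; ring⟩
  have sI : ∀ n : ℤ, (n : ℝ) = (Surd.ofInt n).toReal := fun n => (Surd.toReal_ofInt n).symm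
  have sS : ∀ n : ℤ, √2 * (n : ℝ) = (Surd.ofInt n).sqrtTwoMul.toReal := fun n => by
    rw [Surd.toReal_sqrtTwoMul, Surd.toReal_ofInt]
  have s0 : ((0 : ℤ) : ℝ) = (Surd.ofInt 0).sqrtTwoMul.toReal := by
    rw [← sS, Int.cast_zero, mul_zero]
  simp only [List.mem_cons, Prod.mk.injEq, List.not_mem_nil, or_false] at key
  rcases key with ⟨rfl, rfl, rfl, rfl⟩ | ⟨rfl, rfl, rfl, rfl⟩ | ⟨rfl, rfl, rfl, rfl⟩ |
    ⟨rfl, rfl, rfl, rfl⟩ | ⟨rfl, rfl, rfl, rfl⟩ | ⟨rfl, rfl, rfl, rfl⟩ | ⟨rfl, rfl, rfl, rfl⟩ |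
    ⟨rfl, rfl, rfl, rfl⟩ | ⟨rfl, rfl, rfl, rfl⟩ | ⟨rfl, rfl, rfl, rfl⟩ | ⟨rfl, rfl, rfl, rfl⟩
  · obtain ⟨a, h⟩ := r4 hA
    have he : IsHurwitz _ := .inl ⟨a, rfl⟩
    exact ⟨_, .inl he, hq _ he.norm_toQuat (h.trans (sI _)) ((r0 hB).trans (sI _))
      ((r0 hC).trans (sI _)) ((r0 hD).trans (sI _))⟩
  · obtain ⟨a, h⟩ := r4 hB
    have he : IsHurwitz _ := .inr (.inl ⟨a, rfl⟩)
    exact ⟨_, .inl he, hq _ he.norm_toQuat ((r0 hA).trans (sI _)) (h.trans (sI _))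
      ((r0 hC).trans (sI _)) ((r0 hD).trans (sI _))⟩
  · obtain ⟨a, h⟩ := r4 hC
    have he : IsHurwitz _ := .inr (.inr (.inl ⟨a, rfl⟩))
    exact ⟨_, .inl he, hq _ he.norm_toQuat ((r0 hA).trans (sI _)) ((r0 hB).trans (sI _))
      (h.trans (sI _)) ((r0 hD).trans (sI _))⟩
  · obtain ⟨a, h⟩ := r4 hD
    have he : IsHurwitz _ := .inr (.inr (.inr (.inl ⟨a, rfl⟩)))
    exact ⟨_, .inl he, hq _ he.norm_toQuat ((r0 hA).trans (sI _)) ((r0 hB).trans (sI _))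
      ((r0 hC).trans (sI _)) (h.trans (sI _))⟩
  · obtain ⟨a, ha⟩ := r1 hA
    obtain ⟨b, hb⟩ := r1 hB
    obtain ⟨c, hc⟩ := r1 hC
    obtain ⟨d, hd⟩ := r1 hD
    have he : IsHurwitz _ := .inr (.inr (.inr (.inr ⟨a, b, c, d, rfl⟩)))
    exact ⟨_, .inl he, hq _ he.norm_toQuat (ha.trans (sI _)) (hb.trans (sI _)) (hc.trans (sI _))
      (hd.trans (sI _))⟩
  · obtain ⟨a, ha⟩ := r2 hA
    obtain ⟨b, hb⟩ := r2 hB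
    have he : IsOctahedral _ := .inl ⟨a, b, rfl⟩
    exact ⟨_, .inr he, hq _ he.norm_toQuat (ha.trans (sS _)) (hb.trans (sS _)) ((r0 hC).trans s0)
      ((r0 hD).trans s0)⟩
  · obtain ⟨a, ha⟩ := r2 hA
    obtain ⟨b, hb⟩ := r2 hC
    have he : IsOctahedral _ := .inr (.inl ⟨a, b, rfl⟩)
    exact ⟨_, .inr he, hq _ he.norm_toQuat (ha.trans (sS _)) ((r0 hB).trans s0) (hb.trans (sS _))
      ((r0 hD).trans s0)⟩
  · obtain ⟨a, ha⟩ := r2 hA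
    obtain ⟨b, hb⟩ := r2 hD
    have he : IsOctahedral _ := .inr (.inr (.inl ⟨a, b, rfl⟩))
    exact ⟨_, .inr he, hq _ he.norm_toQuat (ha.trans (sS _)) ((r0 hB).trans s0) ((r0 hC).trans s0)
      (hb.trans (sS _))⟩
  · obtain ⟨a, ha⟩ := r2 hB
    obtain ⟨b, hb⟩ := r2 hC
    have he : IsOctahedral _ := .inr (.inr (.inr (.inl ⟨a, b, rfl⟩)))
    exact ⟨_, .inr he, hq _ he.norm_toQuat ((r0 hA).trans s0) (ha.trans (sS _)) (hb.trans (sS _))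
      ((r0 hD).trans s0)⟩
  · obtain ⟨a, ha⟩ := r2 hB
    obtain ⟨b, hb⟩ := r2 hD
    have he : IsOctahedral _ := .inr (.inr (.inr (.inr (.inl ⟨a, b, rfl⟩))))
    exact ⟨_, .inr he, hq _ he.norm_toQuat ((r0 hA).trans s0) (ha.trans (sS _)) ((r0 hC).trans s0)
      (hb.trans (sS _))⟩
  · obtain ⟨a, ha⟩ := r2 hC
    obtain ⟨b, hb⟩ := r2 hD
    have he : IsOctahedral _ := .inr (.inr (.inr (.inr (.inr ⟨a, b, rfl⟩))))
    exact ⟨_, .inr he, hq _ he.norm_toQuat ((r0 hA).trans s0) ((r0 hB).trans s0) (ha.trans (sS _))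
      (hb.trans (sS _))⟩

theorem exists_eq_half_of_mem_binaryOctahedralGroup {q : S3} (hq : q ∈ binaryOctahedralGroup) :
    ∃ e : SurdQuat, (e.IsHurwitz ∨ e.IsOctahedral) ∧ q = e.half := by
  have hV : ∀ v ∈ octahedronVertices, ∃ x y z : ℤ, v = imQuaternion x y z := by
    rintro v (rfl | rfl | rfl | rfl | rfl | rfl)
    · exact ⟨1, 0, 0, by simp⟩
    · exact ⟨-1, 0, 0, by simp⟩
    · exact ⟨0, 1, 0, by simp⟩
    · exact ⟨0, -1, 0, by simp⟩
    · exact ⟨0, 0, 1, by simp⟩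
    · exact ⟨0, 0, -1, by simp⟩
  refine exists_eq_half_of_integral q fun v hv => hV _ (conj_mem_of_mem_rotationPreimage hq ?_)
  rcases hv with rfl | rfl | rfl <;> simp [octahedronVertices]

/-- Each basis vector is the midpoint of two vertices of the tetrahedron. Their images have
coordinates ±1, so the image of the midpoint is integral and the general classification applies;
`IsOctahedral.half_notMem` removes the second kind. -/
theorem exists_eq_half_of_mem_binaryTetrahedralGroup {q : S3} (hq : q ∈ binaryTetrahedralGroup) :
    ∃ e : SurdQuat, e.IsHurwitz ∧ q = e.half := by
  have hV : ∀ v ∈ tetrahedronVertices, ∃ x y z : Bool,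
      v = imQuaternion (sgn x) (sgn y) (sgn z) := by
    rintro v (rfl | rfl | rfl | rfl)
    · exact ⟨true, true, true, by simp [sgn]⟩
    · exact ⟨true, false, false, by simp [sgn]⟩
    · exact ⟨false, true, false, by simp [sgn]⟩
    · exact ⟨false, false, true, by simp [sgn]⟩
  have hhalf : ∀ x y : Bool, ∃ n : ℤ, (sgn x + sgn y : ℝ) = 2 * n := by
    rintro (_ | _) (_ | _)
    · exact ⟨-1, by norm_num [sgn]⟩
    · exact ⟨0, by norm_num [sgn]⟩
    · exact ⟨0, by norm_num [sgn]⟩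
    · exact ⟨1, by norm_num [sgn]⟩
  have hsum : ∀ v ∈ tetrahedronVertices, ∀ w ∈ tetrahedronVertices, ∃ x y z : ℤ,
      (q : ℍ[ℝ]) * ((2⁻¹ : ℝ) • (v + w)) * star (q : ℍ[ℝ]) = imQuaternion x y z := by
    intro v hv w hw
    obtain ⟨x, y, z, h⟩ := hV _ (conj_mem_of_mem_rotationPreimage hq hv)
    obtain ⟨x', y', z', h'⟩ := hV _ (conj_mem_of_mem_rotationPreimage hq hw)
    obtain ⟨l, hl⟩ := hhalf x x'
    obtain ⟨m, hm⟩ := hhalf y y'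
    obtain ⟨n, hn⟩ := hhalf z z'
    refine ⟨l, m, n, ?_⟩
    rw [mul_smul_comm, smul_mul_assoc, mul_add, add_mul, h, h', imQuaternion_add, smul_imQuaternion,
      hl, hm, hn]
    simp only [inv_mul_cancel_left₀ (two_ne_zero' ℝ)]
  obtain ⟨e, he | he, rfl⟩ := exists_eq_half_of_integral q (by
    rintro v (rfl | rfl | rfl)
    · have := hsum (imQuaternion 1 1 1) (by simp [tetrahedronVertices])
        (imQuaternion 1 (-1) (-1)) (by simp [tetrahedronVertices])
      rwa [show (2⁻¹ : ℝ) • (imQuaternion 1 1 1 + imQuaternion 1 (-1) (-1)) = imQuaternion 1 0 0 by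
        rw [imQuaternion_add, smul_imQuaternion]; norm_num] at this
    · have := hsum (imQuaternion 1 1 1) (by simp [tetrahedronVertices])
        (imQuaternion (-1) 1 (-1)) (by simp [tetrahedronVertices])
      rwa [show (2⁻¹ : ℝ) • (imQuaternion 1 1 1 + imQuaternion (-1) 1 (-1)) = imQuaternion 0 1 0 by
        rw [imQuaternion_add, smul_imQuaternion]; norm_num] at this
    · have := hsum (imQuaternion 1 1 1) (by simp [tetrahedronVertices])
        (imQuaternion (-1) (-1) 1) (by simp [tetrahedronVertices])
      rwa [show (2⁻¹ : ℝ) • (imQuaternion 1 1 1 + imQuaternion (-1) (-1) 1) = imQuaternion 0 0 1 by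
        rw [imQuaternion_add, smul_imQuaternion]; norm_num] at this)
  · exact ⟨e, he, rfl⟩
  · exact absurd hq he.half_notMem

end SurdQuat

/-! ### From verified data to convex triangulations -/

namespace TriangulationData

open SurdQuat

variable {d : TriangulationData}

theorem IsElement.norm_toQuat {e : SurdQuat} (h : d.IsElement e) : ‖e.toQuat‖ = 2 :=
  h.elim (·.norm_toQuat) (·.2.norm_toQuat)

theorem norm_toQuat_transition (h : ∀ e ∈ d.elements, ‖e.toQuat‖ = 2) (i j : ℕ) :
    ‖(d.transition i j).toQuat‖ = 2 := by
  rw [transition, List.getD_eq_getElem?_getD]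
  cases hk : d.elements[(d.transitions.getD i []).getD j 0]? with
  | none =>
    rw [Option.getD_none, toQuat_ofInt_real, Quaternion.norm_coe]
    norm_num
  | some e => exact h e (List.mem_of_getElem? hk)

theorem half_transition_mem {G : Subgroup S3} (h : ∀ e ∈ d.elements, e.half ∈ G) (i j : ℕ) :
    (d.transition i j).half ∈ G := by
  rw [transition, List.getD_eq_getElem?_getD]
  cases hk : d.elements[(d.transitions.getD i []).getD j 0]? with
  | none =>
    convert! G.one_mem
    have hn : ‖(ofInt 2 0 0 0).toQuat‖ = 2 := by
      rw [toQuat_ofInt_real, Quaternion.norm_coe]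
      norm_num
    ext1
    rw [Option.getD_none, coe_half hn, toQuat_ofInt_real, Metric.unitSphere.coe_one]
    ext <;> simp
  | some e => exact h e (List.mem_of_getElem? hk)

theorem head_mem {f : List ℕ} (h : f.length = 4) : head f ∈ f := by
  rw [head, List.getD_eq_getElem _ _ (by omega)]
  exact List.getElem_mem _

theorem dotLin_half {p e : SurdQuat} (N : SurdQuat) (he : ‖e.toQuat‖ = 2) :
    N.dotLin (p.toQuat * e.half) = 2⁻¹ * (N.dot (p.mul e)).toReal := by
  rw [coe_half he, mul_smul_comm, map_smul, ← toQuat_mul, dotLin_toQuat, smul_eq_mul]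

/-- The convex triangulation described by data that pass the check. -/
noncomputable def toConvexTriangulation {G : Subgroup S3} (hd : d.check = true)
    (hn : ∀ e ∈ d.elements, ‖e.toQuat‖ = 2) (hG : ∀ e ∈ d.elements, e.half ∈ G)
    (hG' : ∀ g ∈ G, ∃ e, d.IsElement e ∧ g = e.half) :
    ConvexTriangulation G d.points.length {f // f ∈ d.facets} :=
  have hf : ∀ f ∈ d.facets, d.checkFacet f = true := by
    rw [check, Bool.and_eq_true, List.all_eq_true] at hd
    exact hd.2
  have hshape : ∀ f ∈ d.facets, f.length = 4 ∧ f.Nodup ∧ ∀ j ∈ f, j < d.points.length := by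
    intro f hfm
    have := hf f hfm
    simp only [checkFacet, checkShape, Bool.and_eq_true, List.all_eq_true, decide_eq_true_eq,
      Nat.blt_eq] at this
    exact ⟨Nat.eq_of_beq_eq_true this.1.1.1.1.1.1, this.1.1.1.1.1.2, this.1.1.1.1.2⟩
  have hadj : ∀ f ∈ d.facets, d.checkAdj f = true := by
    intro f hfm
    have := hf f hfm
    simp only [checkFacet, Bool.and_eq_true] at this
    exact this.1.1.1.2
  have hcoc : ∀ f ∈ d.facets, d.checkCocycle f = true := by
    intro f hfm
    have := hf f hfm
    simp only [checkFacet, Bool.and_eq_true] at this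
    exact this.1.1.2
  have hon : ∀ f ∈ d.facets, d.checkOn f (d.normal f) (d.level f) = true := by
    intro f hfm
    have := hf f hfm
    simp only [checkFacet, Bool.and_eq_true] at this
    exact this.1.2
  have hbelow : ∀ f ∈ d.facets, d.checkBelow f (d.normal f) (d.level f) = true := by
    intro f hfm
    have := hf f hfm
    simp only [checkFacet, Bool.and_eq_true] at this
    exact this.2
  have hpos : ∀ f ∈ d.facets, 0 < (d.level f).toReal := by
    intro f hfm
    have := hon f hfm
    rw [checkOn, Bool.and_eq_true] at this
    exact Surd.toReal_pos this.1
  { vert := fun f => Finset.univ.filter fun i => i.val ∈ f.1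
    base := fun f => ⟨head f.1, (hshape f.1 f.2).2.2 _ (head_mem (hshape f.1 f.2).1)⟩
    p := fun i => (d.point i).toQuat
    φ := fun i j => (d.transition i j).half
    -- The level is computed at doubled vertices, hence the factor 2.
    ν := fun f => (2 * (d.level f.1).toReal⁻¹) • (d.normal f.1).dotLin
    card_vert := by
      rintro ⟨f, hfm⟩
      obtain ⟨h4, hnd, hlt⟩ := hshape f hfm
      rw [← h4, ← List.toFinset_card_of_nodup hnd]
      refine Finset.card_bij (fun i _ => i.val) (fun i hi => by simpa using hi)
        (fun i _ j _ h => Fin.ext h) fun k hk => ?_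
      rw [List.mem_toFinset] at hk
      exact ⟨⟨k, hlt k hk⟩, by simpa using hk, rfl⟩
    exists_mem_vert := by
      intro i
      rw [check, checkCover, Bool.and_eq_true, Bool.and_eq_true, List.all_eq_true] at hd
      obtain ⟨f, hfm, hif⟩ := List.any_eq_true.1 (hd.1.2 i (List.mem_range.2 i.2))
      exact ⟨⟨f, hfm⟩, by simpa using hif⟩
    φ_mem := fun f j _ => half_transition_mem hG _ _
    cocycle := by
      rintro ⟨f, hfm⟩ j hj k hk
      have h := hcoc f hfm
      simp only [checkCocycle, List.all_eq_true] at h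
      have := toQuat_eq_of_beq (h j (by simpa using hj) k (by simpa using hk))
      rw [toQuat_mul, toQuat_mul, toQuat_ofInt_real, Quaternion.coe_mul_eq_smul] at this
      ext1
      rw [Metric.unitSphere.coe_mul, coe_half (norm_toQuat_transition hn _ _),
        coe_half (norm_toQuat_transition hn _ _), coe_half (norm_toQuat_transition hn _ _),
        smul_mul_smul_comm, ← this, smul_smul]
      norm_num
    ν_eq_one := by
      rintro ⟨f, hfm⟩ j hj
      have h := hon f hfm
      simp only [checkOn, Bool.and_eq_true, List.all_eq_true] at h
      have := Surd.toReal_eq_of_beq (h.2 j (by simpa using hj))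
      rw [LinearMap.smul_apply, dotLin_half _ (norm_toQuat_transition hn _ _)]
      change 2 * (d.level f).toReal⁻¹ * (2⁻¹ * ((d.normal f).dot (d.vertex (head f) j)).toReal) = 1
      rw [this]
      have := (hpos f hfm).ne'
      field_simp
    ν_lt_one := by
      rintro ⟨f, hfm⟩ i g hg hne
      obtain ⟨e, he, rfl⟩ := hG' g hg
      have h := hbelow f hfm
      simp only [checkBelow, List.all_eq_true, Bool.and_eq_true] at h
      have hi := h i (List.mem_range.2 i.2)
      obtain ⟨s, hs, hP⟩ : ∃ s : Surd, s.toReal = (d.level f).toReal -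
          (((d.point i).conj.mul (d.normal f)).dot e).toReal ∧
          (s.pos || (f.contains i.val && e.beq (d.transition (head f) i))) = true := by
        rcases he with he | ⟨hoct, he⟩
        · exact allHurwitz_spec hi.1 he
        · have h2 := hi.2
          rw [hoct, Bool.not_true, Bool.false_or] at h2
          exact allOctahedral_spec h2 he
      rw [Bool.or_eq_true] at hP
      rcases hP with hP | hP
      · have hsp := Surd.toReal_pos hP
        rw [hs, dot_conj_mul] at hsp
        rw [LinearMap.smul_apply, dotLin_half _ he.norm_toQuat, smul_eq_mul]
        have hp := hpos f hfm
        have : ((d.normal f).dot ((d.point i).mul e)).toReal / (d.level f).toReal < 1 := by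
          rw [div_lt_one hp]
          linarith
        calc _ = ((d.normal f).dot ((d.point i).mul e)).toReal / (d.level f).toReal := by
              field_simp
          _ < 1 := this
      · rw [Bool.and_eq_true] at hP
        exact absurd ⟨by simpa using hP.1, half_congr (toQuat_eq_of_beq hP.2)⟩ hne
    exists_adj := by
      rintro ⟨f, hfm⟩ k hk
      have h := hadj f hfm
      simp only [checkAdj, List.all_eq_true] at h
      obtain ⟨f', hfm', h'⟩ := List.any_eq_true.1 (h k (by simpa using hk))
      rw [Bool.and_eq_true, List.all_eq_true] at h'
      refine ⟨⟨f', hfm'⟩, by simpa using h'.1, fun j hj => ?_⟩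
      rw [Finset.mem_erase, Finset.mem_filter] at hj
      have := h'.2 j hj.2.2
      rw [Bool.or_eq_true] at this
      rcases this with h1 | h1
      · exact absurd (Fin.ext (Nat.eq_of_beq_eq_true h1)) hj.1
      · simpa using h1 }

theorem hasTriangulationWithVertices {G : Subgroup S3} (hd : d.check = true)
    (hn : ∀ e ∈ d.elements, ‖e.toQuat‖ = 2) (hG : ∀ e ∈ d.elements, e.half ∈ G)
    (hG' : ∀ g ∈ G, ∃ e, d.IsElement e ∧ g = e.half) :
    HasTriangulationWithVertices (S3 ⧸ G) d.points.length := by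
  have hfin : Finite G := by
    refine Set.Finite.subset ((finite_isHurwitz.union finite_isOctahedral).image half) ?_
    intro g hg
    obtain ⟨e, he, rfl⟩ := hG' g hg
    exact ⟨e, he.imp id (·.2), rfl⟩
  have : Finite {f // f ∈ d.facets} := List.finite_toSet d.facets
  have : Nonempty {f // f ∈ d.facets} := by
    rw [check, checkCover, Bool.and_eq_true, Bool.and_eq_true] at hd
    have : d.facets ≠ [] := by simpa using hd.1.1
    obtain ⟨f, hf⟩ := List.exists_mem_of_ne_nil _ this
    exact ⟨⟨f, hf⟩⟩
  exact (toConvexTriangulation hd hn hG hG').hasTriangulationWithVertices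

end TriangulationData

/-! ### The two explicit triangulations -/

/-- A triangulation of the octahedral space with 15 vertices. -/
def octahedralSpaceData : TriangulationData where
  octahedral := false
  elements := hurwitzUnits
  -- Only convex position matters: the representatives need not lie on a common sphere, so integral
  -- coordinates suffice.
  points := [
    .ofInt 65 430 (-254) (-25), .ofInt 482 (-30) 125 (-26), .ofInt (-280) (-314) (-204) 230,
    .ofInt (-238) (-68) 441 75, .ofInt 120 (-297) (-393) 3, .ofInt 322 (-134) (-359) (-94),
    .ofInt 130 187 446 129, .ofInt (-290) 29 56 (-415), .ofInt 505 (-123) 17 (-25),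
    .ofInt (-135) (-212) 355 273, .ofInt 222 (-76) (-430) (-130), .ofInt (-60) (-491) 32 (-118),
    .ofInt 38 (-66) (-410) 309, .ofInt (-508) 13 37 (-80), .ofInt 59 (-461) (-145) (-156)]
  transitions := [
    [0, 3, 6, 16, 6, 11, 16, 5, 3, 16, 15, 14, 9, 12, 14],
    [2, 0, 14, 4, 5, 5, 9, 16, 0, 10, 5, 0, 14, 1, 23],
    [7, 16, 0, 12, 17, 17, 12, 3, 16, 13, 19, 9, 7, 15, 9],
    [14, 5, 18, 0, 0, 20, 15, 9, 20, 0, 1, 17, 18, 4, 16],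
    [7, 4, 15, 0, 0, 0, 8, 3, 9, 12, 0, 11, 21, 22, 11],
    [21, 4, 15, 10, 0, 0, 8, 22, 9, 10, 0, 3, 13, 22, 11],
    [14, 23, 18, 17, 22, 22, 0, 2, 23, 19, 1, 16, 14, 8, 22],
    [4, 14, 2, 23, 2, 8, 3, 0, 12, 22, 2, 21, 16, 21, 12],
    [2, 0, 14, 10, 23, 23, 9, 18, 0, 10, 23, 3, 5, 1, 23],
    [14, 20, 19, 0, 18, 20, 13, 8, 20, 0, 18, 17, 22, 4, 7],
    [17, 4, 13, 1, 0, 0, 1, 3, 9, 12, 0, 15, 13, 22, 15],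
    [16, 0, 23, 15, 21, 2, 14, 11, 2, 15, 17, 0, 20, 3, 0],
    [23, 16, 6, 12, 11, 19, 16, 14, 4, 8, 19, 10, 0, 14, 11],
    [18, 1, 17, 5, 8, 8, 22, 11, 1, 5, 8, 2, 16, 0, 2],
    [16, 9, 23, 14, 21, 21, 8, 18, 9, 6, 17, 0, 21, 3, 0]]
  facets := [
    [0, 1, 9, 4], [0, 1, 4, 14], [0, 1, 8, 9], [0, 1, 14, 8], [0, 2, 3, 10], [0, 2, 13, 3],
    [0, 2, 6, 5], [0, 2, 5, 7], [0, 2, 10, 6], [0, 2, 7, 13], [0, 3, 9, 8], [0, 3, 8, 14],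
    [0, 3, 13, 9], [0, 3, 14, 10], [0, 4, 9, 7], [0, 4, 7, 12], [0, 4, 12, 11], [0, 4, 11, 14],
    [0, 5, 6, 11], [0, 5, 12, 7], [0, 5, 11, 12], [0, 6, 10, 11], [0, 7, 9, 13], [0, 10, 14, 11],
    [1, 2, 10, 3], [1, 2, 3, 13], [1, 2, 8, 9], [1, 2, 13, 8], [1, 2, 9, 10], [1, 3, 7, 6],
    [1, 3, 6, 13], [1, 3, 12, 7], [1, 3, 10, 12], [1, 4, 5, 10], [1, 4, 14, 5], [1, 4, 10, 9],
    [1, 5, 7, 12], [1, 5, 14, 7], [1, 5, 12, 10], [1, 6, 7, 14], [1, 6, 8, 13], [1, 6, 14, 8],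
    [2, 4, 6, 5], [2, 4, 5, 14], [2, 4, 12, 6], [2, 4, 11, 12], [2, 4, 14, 11], [2, 5, 7, 14],
    [2, 6, 9, 10], [2, 6, 12, 9], [2, 7, 13, 14], [2, 8, 9, 11], [2, 8, 11, 13], [2, 9, 12, 11],
    [2, 11, 14, 13], [3, 5, 11, 6], [3, 5, 6, 13], [3, 5, 9, 11], [3, 5, 13, 9], [3, 6, 11, 7],
    [3, 7, 11, 8], [3, 7, 8, 12], [3, 8, 11, 9], [3, 8, 14, 12], [3, 10, 12, 14], [4, 5, 8, 6],
    [4, 5, 13, 8], [4, 5, 10, 13], [4, 6, 8, 12], [4, 7, 8, 10], [4, 7, 12, 8], [4, 7, 10, 9],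
    [4, 8, 13, 10], [5, 6, 13, 8], [5, 9, 11, 12], [5, 9, 12, 13], [5, 10, 13, 12], [6, 7, 9, 10],
    [6, 7, 14, 9], [6, 7, 10, 11], [6, 8, 12, 14], [6, 9, 14, 12], [7, 8, 10, 11], [7, 9, 13, 14],
    [8, 10, 11, 13], [9, 12, 13, 14], [10, 11, 13, 14], [10, 12, 14, 13]]

/-- A triangulation of the truncated cube space with 16 vertices. -/
def truncatedCubeSpaceData : TriangulationData where
  octahedral := true
  elements := hurwitzUnits ++ octahedralUnits
  points := [
    .ofInt (-155) 26 (-308) 304, .ofInt 190 (-269) (-304) (-99), .ofInt (-303) 74 (-274) (-198),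
    .ofInt 224 (-106) (-381) 23, .ofInt (-11) (-86) 199 414, .ofInt 279 332 22 (-135),
    .ofInt (-145) 35 (-427) 62, .ofInt (-198) 111 179 361, .ofInt 176 (-173) (-245) 291,
    .ofInt 411 178 6 116, .ofInt 104 (-370) (-113) 244, .ofInt (-392) (-217) (-55) 72,
    .ofInt 208 (-388) 45 (-115), .ofInt 188 (-390) 5 156, .ofInt (-199) (-41) (-392) 112,
    .ofInt (-353) 283 59 2]
  -- Only entries for two labels of a common facet affect the check.
  transitions := [
    [0, 37, 15, 37, 2, 22, 27, 21, 29, 7, 9, 13, 28, 36, 0, 5],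
    [38, 0, 43, 25, 12, 16, 21, 12, 13, 36, 13, 39, 11, 33, 0, 34],
    [17, 40, 0, 44, 20, 37, 0, 7, 36, 28, 24, 21, 32, 12, 25, 35],
    [38, 27, 47, 0, 40, 46, 31, 24, 0, 36, 33, 14, 11, 6, 31, 20],
    [3, 18, 10, 43, 0, 5, 3, 0, 43, 47, 19, 11, 0, 0, 3, 6],
    [8, 14, 38, 45, 4, 0, 12, 4, 41, 11, 10, 1, 3, 26, 12, 2],
    [25, 11, 0, 29, 2, 18, 0, 20, 36, 46, 40, 13, 0, 8, 0, 47],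
    [11, 18, 6, 26, 0, 5, 10, 0, 43, 47, 46, 9, 16, 46, 11, 33],
    [31, 19, 39, 0, 40, 42, 39, 40, 0, 17, 11, 41, 4, 29, 15, 30],
    [6, 39, 30, 39, 44, 21, 45, 44, 15, 0, 3, 32, 43, 37, 14, 0],
    [23, 19, 26, 35, 13, 20, 43, 45, 21, 2, 0, 41, 29, 25, 23, 14],
    [19, 36, 11, 16, 21, 1, 19, 23, 42, 34, 42, 0, 2, 2, 19, 3],
    [30, 21, 34, 21, 0, 2, 0, 14, 5, 40, 31, 3, 0, 31, 22, 1],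
    [39, 35, 18, 7, 0, 24, 22, 45, 31, 38, 27, 3, 29, 0, 39, 0],
    [0, 0, 27, 29, 2, 18, 0, 21, 17, 16, 9, 13, 8, 36, 0, 0],
    [4, 32, 33, 10, 7, 3, 44, 35, 28, 0, 16, 2, 1, 0, 0, 0]]
  facets := [
    [0, 1, 6, 9], [0, 1, 15, 6], [0, 1, 12, 8], [0, 1, 8, 15], [0, 1, 9, 12], [0, 2, 3, 7],
    [0, 2, 12, 3], [0, 2, 4, 8], [0, 2, 11, 4], [0, 2, 7, 11], [0, 2, 8, 12], [0, 3, 9, 5],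
    [0, 3, 5, 13], [0, 3, 13, 7], [0, 3, 12, 9], [0, 4, 15, 8], [0, 4, 14, 10], [0, 4, 10, 15],
    [0, 4, 11, 14], [0, 5, 9, 13], [0, 6, 13, 9], [0, 6, 10, 13], [0, 6, 15, 10], [0, 7, 14, 11],
    [0, 7, 13, 14], [0, 10, 14, 13], [1, 2, 10, 5], [1, 2, 5, 13], [1, 2, 11, 10], [1, 2, 13, 11],
    [1, 3, 6, 4], [1, 3, 4, 10], [1, 3, 15, 6], [1, 3, 10, 11], [1, 3, 11, 15], [1, 4, 7, 5],
    [1, 4, 5, 10], [1, 4, 6, 9], [1, 4, 9, 7], [1, 5, 7, 13], [1, 7, 9, 12], [1, 7, 12, 13],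
    [1, 8, 11, 13], [1, 8, 15, 11], [1, 8, 13, 12], [2, 3, 7, 15], [2, 3, 15, 12], [2, 4, 8, 9],
    [2, 4, 9, 11], [2, 5, 13, 9], [2, 5, 9, 14], [2, 5, 15, 10], [2, 5, 14, 12], [2, 5, 12, 15],
    [2, 7, 11, 10], [2, 7, 10, 15], [2, 8, 14, 9], [2, 8, 12, 14], [2, 9, 13, 11], [3, 4, 14, 6],
    [3, 4, 10, 14], [3, 5, 7, 6], [3, 5, 6, 14], [3, 5, 13, 7], [3, 5, 14, 9], [3, 6, 7, 15],
    [3, 9, 10, 12], [3, 9, 14, 10], [3, 10, 11, 12], [3, 11, 15, 12], [4, 5, 8, 7], [4, 5, 15, 8],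
    [4, 5, 10, 15], [4, 6, 9, 11], [4, 6, 11, 14], [4, 7, 8, 9], [5, 6, 8, 7], [5, 6, 11, 8],
    [5, 6, 14, 11], [5, 8, 11, 15], [5, 11, 14, 12], [5, 11, 12, 15], [6, 7, 10, 8],
    [6, 7, 15, 10], [6, 8, 10, 13], [6, 8, 13, 11], [6, 9, 11, 13], [7, 8, 9, 10], [7, 9, 12, 10],
    [7, 10, 12, 11], [7, 11, 12, 14], [7, 12, 13, 14], [8, 9, 10, 14], [8, 10, 13, 14],
    [8, 12, 14, 13]]

theorem check_octahedralSpaceData : octahedralSpaceData.check = true := by decide +kernel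

theorem check_truncatedCubeSpaceData : truncatedCubeSpaceData.check = true := by decide +kernel

theorem norm_toQuat_of_mem_units {e : SurdQuat} (he : e ∈ hurwitzUnits ++ octahedralUnits) :
    ‖e.toQuat‖ = 2 := by
  -- For the empty list of vectors, `preserves` reduces to the norm condition.
  have : ((hurwitzUnits ++ octahedralUnits).all fun e => e.preserves []) = true := by
    decide +kernel
  exact SurdQuat.norm_toQuat_of_preserves (List.all_eq_true.1 this e he)

theorem hasTriangulationWithVertices_octahedralSpace :
    HasTriangulationWithVertices OctahedralSpace 15 :=
  TriangulationData.hasTriangulationWithVertices check_octahedralSpaceData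
    (fun _ he => norm_toQuat_of_mem_units (List.mem_append_left _ he))
    (fun _ he => SurdQuat.half_mem_binaryTetrahedralGroup he) fun _ hg =>
    (SurdQuat.exists_eq_half_of_mem_binaryTetrahedralGroup hg).imp fun _ h => ⟨.inl h.1, h.2⟩

theorem hasTriangulationWithVertices_truncatedCubeSpace :
    HasTriangulationWithVertices TruncatedCubeSpace 16 :=
  TriangulationData.hasTriangulationWithVertices check_truncatedCubeSpaceData
    (fun _ he => norm_toQuat_of_mem_units he)
    (fun _ he => SurdQuat.half_mem_binaryOctahedralGroup he) fun _ hg =>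
    (SurdQuat.exists_eq_half_of_mem_binaryOctahedralGroup hg).imp fun _ h =>
      ⟨h.1.imp id fun h => ⟨rfl, h⟩, h.2⟩

theorem mainTheorem3 :
    HasTriangulationWithVertices OctahedralSpace 15 ∧
      HasTriangulationWithVertices TruncatedCubeSpace 16 :=
  ⟨hasTriangulationWithVertices_octahedralSpace, hasTriangulationWithVertices_truncatedCubeSpace⟩
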